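/- **Setting.** Consider the impulsive system with constant delays $h_c>0$ and $h_d\in\mathbb Z_{\ge0}$ $$\begin{aligned} \dot x(t)&=Ax(t)+G_cx(t-h_c)+E_cw_c(t),\quad t\neq t_k,\\ x(t_k^+)&=Jx(t_k)+G_dx(t_{k-h_d})+E_dw_d(k),\quad k\ge1,\\ y_c(t)&=C_{yc}x(t)+H_{yc}x(t-h_c)+F_{yc}w_c(t),\\ y_d(k)&=C_{yd}x(t_k)+H_{yd}x(t_{k-h_d})+F_{yd}w_d(k), \end{aligned}$$ with $x(t)\in\mathbb R^n$, $w_c(t)\in\mathbb R^{p_c}$, $w_d(k)\in\mathbb R^{p_d}$, $y_c(t)\in\mathbb R^{r_c}$, $y_d(k)\in\mathbb R^{r_d}$. Trajectories are left-continuous at the impulses and satisfy the integrated equation on each interval $(t_k,t_{k+1}]$. The initial data are a continuous function $x=\phi_0$ on $[-h_c,0]$ and, for the discrete delay, arbitrary prescribed values of "$x(t_j)$" for $1-h_d\le j<0$; the size of the initial data is the supremum of their norms. The impulse times satisfy the range dwell-time condition $[T_{\min},T_{\max}]$, where $0\le T_{\min}\le T_{\max}<\infty$: $t_0=0$ (no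 jump there), $t_{k+1}-t_k>0$, $t_{k+1}-t_k\in[T_{\min},T_{\max}]$ for all $k\ge0$, and $t_k\to\infty$. Given $\tilde L_c:[0,T_{\max}]\to\mathbb R^{n\times r_c}$ and $L_d\in\mathbb R^{n\times r_d}$, put $L_c(t)=\tilde L_c(t-t_k)$ for $t\in(t_k,t_{k+1}]$ and consider, for $\bullet\in\{-,+\}$, the observers $$\begin{aligned} \dot x^\bullet(t)&=Ax^\bullet(t)+G_cx^\bullet(t-h_c)+E_cw_c^\bullet(t)+L_c(t)\bigl(y_c(t)-C_{yc}x^\bullet(t)-H_{yc}x^\bullet(t-h_c)-F_{yc}w_c^\bullet(t)\bigr),\\ x^\bullet(t_k^+)&=Jx^\bullet(t_k)+G_dx^\bullet(t_{k-h_d})+E_dw_d^\bullet(k)+L_d\bigl(y_d(k)-C_{yd}x^\bullet(t_k)-H_{yd}x^\bullet(t_{k-h_d})-F_{yd}w_d^\bullet(k)\bigr), \end{aligned}$$ where $w_c^-\le w_c\le w_c^+$ and $w_d^-\le w_d\le w_d^+$. With $e^+=x^+-x$, $e^-=x-x^-$, $\delta^+=w^+-w$, $\delta^-=w-w^-$,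 the error dynamics is $$\begin{aligned} \dot e(t)&=(A-L_c(t)C_{yc})e(t)+(G_c-L_c(t)H_{yc})e(t-h_c)+(E_c-L_c(t)F_{yc})\delta_c(t),\\ e(t_k^+)&=(J-L_dC_{yd})e(t_k)+(G_d-L_dH_{yd})e(t_{k-h_d})+(E_d-L_dF_{yd})\delta_d(k), \end{aligned}$$ with performance outputs $e_c(t)=M_ce(t)$ and $e_d(k)=M_de(t_k)$, $k\ge1$, for given entrywise nonnegative $M_c,M_d\in\mathbb R^{n\times n}$. **Theorem.** Assume that there exist a differentiable $X:[0,T_{\max}]\to\mathbb R^{n\times n}$ with diagonal values, $X(0)\succ0$ and $X(\tau)$ invertible for all $\tau\in[0,T_{\max}]$, a function $Y_c:[0,T_{\max}]\to\mathbb R^{n\times r_c}$, a matrix $Y_d\in\mathbb R^{n\times r_d}$, a diagonal $U_c\succ0$ and scalars $\varepsilon,\alpha,\gamma>0$ such that, entrywise, for all $\tau\in[0,T_{\max}]$ and all $\theta\in[T_{\min},T_{\max}]$, $$\begin{aligned} &X(\tau)A-Y_c(\tau)C_{yc}+\alpha I\ge0,\qquad X(\tau)G_c-Y_c(\tau)H_{yc}\ge0,\qquad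 X(\tau)E_c-Y_c(\tau)F_{yc}\ge0,\\ &X(0)J-Y_dC_{yd}\ge0,\qquad X(0)G_d-Y_dH_{yd}\ge0,\qquad X(0)E_d-Y_dF_{yd}\ge0,\\ &\mathbf 1^T[\dot X(\tau)+X(\tau)A-Y_c(\tau)C_{yc}+U_c]+\mathbf 1^TM_c\le0,\\ &\mathbf 1^T[X(\tau)G_c-Y_c(\tau)H_{yc}-U_c]\le0,\\ &\mathbf 1^T[X(\tau)E_c-Y_c(\tau)F_{yc}]-\gamma\mathbf 1^T\le0,\\ &\mathbf 1^T[X(0)(J+G_d)-Y_d(C_{yd}+H_{yd})-X(\theta)+\varepsilon I]+\mathbf 1^TM_d\le0,\\ &\mathbf 1^T[X(0)E_d-Y_dF_{yd}]-\gamma\mathbf 1^T\le0. \end{aligned}$$ Then, with the gains $\tilde L_c(\tau)=X(\tau)^{-1}Y_c(\tau)$ and $L_d=X(0)^{-1}Y_d$, the following hold. * *Interval observer.* For every impulse sequence satisfying the range dwell-time condition, all trajectories of the system and of the two observers whose inputs and initial data are bracketed ($w^-\le w\le w^+$, and likewise for all initial data) satisfy $x^-(t)\le x(t)\le x^+(t)$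 for all $t\ge0$, and $e^\pm$ satisfy the error dynamics with inputs $\delta^\pm$. * (a) *State positivity.* For all $\tau\in[0,T_{\max}]$, $A-\tilde L_c(\tau)C_{yc}$ is Metzler and $G_c-\tilde L_c(\tau)H_{yc}$, $E_c-\tilde L_c(\tau)F_{yc}$ are nonnegative; $J-L_dC_{yd}$, $G_d-L_dH_{yd}$, $E_d-L_dF_{yd}$ are nonnegative. * (b) *Asymptotic stability under range dwell-time $[T_{\min},T_{\max}]$.* For $\delta_c\equiv0$, $\delta_d\equiv0$: for each $\epsilon'>0$ there is $\eta>0$ such that, for every admissible impulse sequence, each error trajectory with initial data of size at most $\eta$ satisfies $\|e(t)\|<\epsilon'$ for all $t\ge0$; and every error trajectory tends to $0$ as $t\to\infty$. * (c) *Hybrid $L_1/\ell_1$-gain at most $\gamma$.* There is a strictly increasing $v$ on $[0,\infty)$ with $v(0)=0$ and $v(s)\to\infty$ as $s\to\infty$ such that, for every admissible impulse sequence, all $\delta_c\in L_1$, $\delta_d\in\ell_1$ and every error trajectory with initial data of size at most $R$, one has $e_c\in L_1$, $e_d\in\ell_1$ and $$\|e_c\|_{L_1}+\|e_d\|_{\ell_1}\le\gamma\bigl(\|\delta_c\|_{L_1}+\|\delta_d\|_{\ell_1}\bigr)+v(R),$$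 where vectors are measured in the $1$-norm in $\|\cdot\|_{L_1}$, $\|\cdot\|_{\ell_1}$ and the discrete-time sums run over $k\ge1$. -/

import Mathlib

open Matrix Set Filter Topology MeasureTheory

/-- Entrywise nonnegative matrix. -/
def EntrywiseNonneg {m n : ℕ} (M : Matrix (Fin m) (Fin n) ℝ) : Prop :=
  ∀ i j, 0 ≤ M i j

/-- Metzler matrix: all off-diagonal entries are nonnegative. -/
def IsMetzler {n : ℕ} (M : Matrix (Fin n) (Fin n) ℝ) : Prop :=
  ∀ i j, i ≠ j → 0 ≤ M i j

/-- The `1`-norm of a vector. -/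
def vecL1 {n : ℕ} (v : Fin n → ℝ) : ℝ := ∑ i, |v i|

/-- The impulse instants `0 = t 0 < t 1 < t 2 < ⋯ → ∞` have all their dwell-times
`t (k + 1) - t k` in `[Tmin, Tmax]`. -/
structure RangeDwellTime (Tmin Tmax : ℝ) (t : ℕ → ℝ) : Prop where
  zero : t 0 = 0
  lt_succ : ∀ k, t k < t (k + 1)
  dwell_mem : ∀ k, t (k + 1) - t k ∈ Icc Tmin Tmax
  tendsto : Tendsto t atTop atTop

/-- The sampled state `x (t j)`. For a negative index `j` it is the prescribed initial datum `ψ j` of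
the discrete delay. -/
def sampledState {n : ℕ} (t : ℕ → ℝ) (x : ℝ → Fin n → ℝ) (ψ : ℤ → Fin n → ℝ) (j : ℤ) :
    Fin n → ℝ :=
  if 0 ≤ j then x (t j.toNat) else ψ j

/-- The state `x (t k ⁺)` right after the instant `t k`; there is no jump at `t 0 = 0`. -/
def postJumpState {n : ℕ} (hd : ℕ) (t : ℕ → ℝ)
    (jump : ℕ → (Fin n → ℝ) → (Fin n → ℝ) → (Fin n → ℝ))
    (x : ℝ → Fin n → ℝ) (ψ : ℤ → Fin n → ℝ) (k : ℕ) : Fin n → ℝ :=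
  if k = 0 then x 0 else jump k (x (t k)) (sampledState t x ψ ((k : ℤ) - hd))

/-- `x` (left-continuous at the impulses) is a trajectory of the impulsive system with delays

* `x' (s) = flow s (x s) (x (s - hc))` for `s ≠ t k`,
* `x (t k ⁺) = jump k (x (t k)) (x (t (k - hd)))` for `k ≥ 1`,

in the sense of Caratheodory (integrated equation on each `(t k, t (k + 1)]`). The initial data are
the continuous restriction of `x` to `[-hc, 0]` and the values `ψ j`, `1 - hd ≤ j < 0`. -/
structure IsTrajectory {n : ℕ} (hc : ℝ) (hd : ℕ) (t : ℕ → ℝ)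
    (flow : ℝ → (Fin n → ℝ) → (Fin n → ℝ) → (Fin n → ℝ))
    (jump : ℕ → (Fin n → ℝ) → (Fin n → ℝ) → (Fin n → ℝ))
    (x : ℝ → Fin n → ℝ) (ψ : ℤ → Fin n → ℝ) : Prop where
  initial_continuous : ContinuousOn x (Icc (-hc) 0)
  integrable : ∀ k,
    IntegrableOn (fun s => flow s (x s) (x (s - hc))) (Ioc (t k) (t (k + 1)))
  integral_eq : ∀ k, ∀ r ∈ Ioc (t k) (t (k + 1)),
    x r = postJumpState hd t jump x ψ k + ∫ s in (t k)..r, flow s (x s) (x (s - hc))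

/-- The size of the initial data of a trajectory is at most `R`. -/
def InitialDataBound {n : ℕ} (hc : ℝ) (hd : ℕ) (x : ℝ → Fin n → ℝ) (ψ : ℤ → Fin n → ℝ)
    (R : ℝ) : Prop :=
  (∀ s ∈ Icc (-hc) 0, ‖x s‖ ≤ R) ∧ ∀ j ∈ Ico (1 - (hd : ℤ)) 0, ‖ψ j‖ ≤ R

/-- Order between two sets of initial data. -/
def InitialDataLE {n : ℕ} (hc : ℝ) (hd : ℕ) (x : ℝ → Fin n → ℝ) (ψ : ℤ → Fin n → ℝ)
    (x' : ℝ → Fin n → ℝ) (ψ' : ℤ → Fin n → ℝ) : Prop :=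
  (∀ s ∈ Icc (-hc) 0, x s ≤ x' s) ∧ ∀ j ∈ Ico (1 - (hd : ℤ)) 0, ψ j ≤ ψ' j

/-- The data of a linear impulsive system with constant delays and measured outputs. -/
structure ImpulsiveDelaySystem (n pc pd rc rd : ℕ) where
  A : Matrix (Fin n) (Fin n) ℝ
  Gc : Matrix (Fin n) (Fin n) ℝ
  Ec : Matrix (Fin n) (Fin pc) ℝ
  J : Matrix (Fin n) (Fin n) ℝ
  Gd : Matrix (Fin n) (Fin n) ℝ
  Ed : Matrix (Fin n) (Fin pd) ℝ
  Cyc : Matrix (Fin rc) (Fin n) ℝ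
  Hyc : Matrix (Fin rc) (Fin n) ℝ
  Fyc : Matrix (Fin rc) (Fin pc) ℝ
  Cyd : Matrix (Fin rd) (Fin n) ℝ
  Hyd : Matrix (Fin rd) (Fin n) ℝ
  Fyd : Matrix (Fin rd) (Fin pd) ℝ
  hc : ℝ
  hc_pos : 0 < hc
  hd : ℕ

namespace ImpulsiveDelaySystem

variable {n pc pd rc rd : ℕ} (P : ImpulsiveDelaySystem n pc pd rc rd)

/-- `x` is a state trajectory of the system with inputs `wc`, `wd`. -/
def IsStateTrajectory (t : ℕ → ℝ) (wc : ℝ → Fin pc → ℝ) (wd : ℕ → Fin pd → ℝ)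
    (x : ℝ → Fin n → ℝ) (ψ : ℤ → Fin n → ℝ) : Prop :=
  IsTrajectory P.hc P.hd t
    (fun s a b => P.A *ᵥ a + P.Gc *ᵥ b + P.Ec *ᵥ wc s)
    (fun k a b => P.J *ᵥ a + P.Gd *ᵥ b + P.Ed *ᵥ wd k) x ψ

/-- The continuous-time measured output. -/
def outputC (wc : ℝ → Fin pc → ℝ) (x : ℝ → Fin n → ℝ) (s : ℝ) : Fin rc → ℝ :=
  P.Cyc *ᵥ x s + P.Hyc *ᵥ x (s - P.hc) + P.Fyc *ᵥ wc s

/-- The discrete-time measured output. -/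
def outputD (t : ℕ → ℝ) (wd : ℕ → Fin pd → ℝ) (x : ℝ → Fin n → ℝ) (ψ : ℤ → Fin n → ℝ) (k : ℕ) :
    Fin rd → ℝ :=
  P.Cyd *ᵥ x (t k) + P.Hyd *ᵥ sampledState t x ψ ((k : ℤ) - P.hd) + P.Fyd *ᵥ wd k

/-- `z` is a trajectory of the observer with gains `Lc (·)`, `Ld`, driven by the measurements
`yc`, `yd` and by the known input bounds `vc`, `vd`. -/
def IsObserverTrajectory (t : ℕ → ℝ) (Lc : ℝ → Matrix (Fin n) (Fin rc) ℝ)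
    (Ld : Matrix (Fin n) (Fin rd) ℝ) (yc : ℝ → Fin rc → ℝ) (yd : ℕ → Fin rd → ℝ)
    (vc : ℝ → Fin pc → ℝ) (vd : ℕ → Fin pd → ℝ)
    (z : ℝ → Fin n → ℝ) (ψ : ℤ → Fin n → ℝ) : Prop :=
  IsTrajectory P.hc P.hd t
    (fun s a b => P.A *ᵥ a + P.Gc *ᵥ b + P.Ec *ᵥ vc s
      + Lc s *ᵥ (yc s - P.Cyc *ᵥ a - P.Hyc *ᵥ b - P.Fyc *ᵥ vc s))
    (fun k a b => P.J *ᵥ a + P.Gd *ᵥ b + P.Ed *ᵥ vd k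
      + Ld *ᵥ (yd k - P.Cyd *ᵥ a - P.Hyd *ᵥ b - P.Fyd *ᵥ vd k)) z ψ

/-- `e` is a trajectory of the error dynamics with inputs `δc`, `δd`. -/
def IsErrorTrajectory (t : ℕ → ℝ) (Lc : ℝ → Matrix (Fin n) (Fin rc) ℝ)
    (Ld : Matrix (Fin n) (Fin rd) ℝ) (δc : ℝ → Fin pc → ℝ) (δd : ℕ → Fin pd → ℝ)
    (e : ℝ → Fin n → ℝ) (ψ : ℤ → Fin n → ℝ) : Prop :=
  IsTrajectory P.hc P.hd t
    (fun s a b => (P.A - Lc s * P.Cyc) *ᵥ a + (P.Gc - Lc s * P.Hyc) *ᵥ b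
      + (P.Ec - Lc s * P.Fyc) *ᵥ δc s)
    (fun k a b => (P.J - Ld * P.Cyd) *ᵥ a + (P.Gd - Ld * P.Hyd) *ᵥ b
      + (P.Ed - Ld * P.Fyd) *ᵥ δd k) e ψ

end ImpulsiveDelaySystem

/-- `Lc (s) = Lt (s - t k)` for `s ∈ (t k, t (k + 1)]`. -/
def IsTimerGain {n rc : ℕ} (t : ℕ → ℝ) (Lt Lc : ℝ → Matrix (Fin n) (Fin rc) ℝ) : Prop :=
  ∀ k, ∀ s ∈ Ioc (t k) (t (k + 1)), Lc s = Lt (s - t k)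

namespace ImpulsiveDelaySystem

variable {n pc pd rc rd : ℕ} (P : ImpulsiveDelaySystem n pc pd rc rd)

/-- State-positivity of the error dynamics. -/
structure ErrorStatePositive (Tmax : ℝ) (Lt : ℝ → Matrix (Fin n) (Fin rc) ℝ)
    (Ld : Matrix (Fin n) (Fin rd) ℝ) : Prop where
  metzler : ∀ τ ∈ Icc 0 Tmax, IsMetzler (P.A - Lt τ * P.Cyc)
  delayC : ∀ τ ∈ Icc 0 Tmax, EntrywiseNonneg (P.Gc - Lt τ * P.Hyc)
  inputC : ∀ τ ∈ Icc 0 Tmax, EntrywiseNonneg (P.Ec - Lt τ * P.Fyc)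
  jump : EntrywiseNonneg (P.J - Ld * P.Cyd)
  delayD : EntrywiseNonneg (P.Gd - Ld * P.Hyd)
  inputD : EntrywiseNonneg (P.Ed - Ld * P.Fyd)

/-- Asymptotic stability of the error dynamics with zero inputs, under range dwell-time
`[Tmin, Tmax]` (stability is uniform in the dwell-time sequence). -/
structure ErrorAsymptoticallyStable (Tmin Tmax : ℝ) (Lt : ℝ → Matrix (Fin n) (Fin rc) ℝ)
    (Ld : Matrix (Fin n) (Fin rd) ℝ) : Prop where
  stable : ∀ ε > 0, ∃ δ > 0, ∀ t, RangeDwellTime Tmin Tmax t → ∀ Lc, IsTimerGain t Lt Lc →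
    ∀ e ψ, P.IsErrorTrajectory t Lc Ld 0 0 e ψ → InitialDataBound P.hc P.hd e ψ δ →
      ∀ s, 0 ≤ s → ‖e s‖ < ε
  attractive : ∀ t, RangeDwellTime Tmin Tmax t → ∀ Lc, IsTimerGain t Lt Lc →
    ∀ e ψ, P.IsErrorTrajectory t Lc Ld 0 0 e ψ → Tendsto e atTop (𝓝 0)

/-- The map from `(δc, δd)` to the performance outputs `(Mc e (·), Md e (t ·))` of the error
dynamics has a hybrid `L₁/ℓ₁`-gain of at most `γ` under range dwell-time `[Tmin, Tmax]`.
The discrete-time signals are indexed by the impulses `k ≥ 1`. -/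
def ErrorHybridGainLE (Mc Md : Matrix (Fin n) (Fin n) ℝ) (Tmin Tmax γ : ℝ)
    (Lt : ℝ → Matrix (Fin n) (Fin rc) ℝ) (Ld : Matrix (Fin n) (Fin rd) ℝ) : Prop :=
  ∃ v : ℝ → ℝ, StrictMonoOn v (Ici 0) ∧ v 0 = 0 ∧ Tendsto v atTop atTop ∧
    ∀ t, RangeDwellTime Tmin Tmax t → ∀ Lc, IsTimerGain t Lt Lc →
    ∀ δc : ℝ → Fin pc → ℝ, IntegrableOn δc (Ioi 0) →
    ∀ δd : ℕ → Fin pd → ℝ, Summable (fun k => vecL1 (δd (k + 1))) →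
    ∀ e ψ, P.IsErrorTrajectory t Lc Ld δc δd e ψ →
    ∀ R, InitialDataBound P.hc P.hd e ψ R →
      IntegrableOn (fun s => vecL1 (Mc *ᵥ e s)) (Ioi 0) ∧
      Summable (fun k => vecL1 (Md *ᵥ e (t (k + 1)))) ∧
      (∫ s in Ioi 0, vecL1 (Mc *ᵥ e s)) + ∑' k, vecL1 (Md *ᵥ e (t (k + 1)))
        ≤ γ * ((∫ s in Ioi 0, vecL1 (δc s)) + ∑' k, vecL1 (δd (k + 1))) + v R

/-- The gains solve the interval observation problem with performance level `γ`: the error dynamics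
is state-positive, asymptotically stable, and has hybrid `L₁/ℓ₁`-gain at most `γ`. -/
structure SolvesObservationProblem (Mc Md : Matrix (Fin n) (Fin n) ℝ) (Tmin Tmax γ : ℝ)
    (Lt : ℝ → Matrix (Fin n) (Fin rc) ℝ) (Ld : Matrix (Fin n) (Fin rd) ℝ) : Prop where
  positive : P.ErrorStatePositive Tmax Lt Ld
  stable : P.ErrorAsymptoticallyStable Tmin Tmax Lt Ld
  gain : P.ErrorHybridGainLE Mc Md Tmin Tmax γ Lt Ld

/-- The gains define an interval observer: whenever the inputs and the initial data are bracketed,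
the errors `xp - x` and `x - xm` obey the error dynamics and `xm ≤ x ≤ xp` for all times. -/
def IsIntervalObserver (Tmin Tmax : ℝ) (Lt : ℝ → Matrix (Fin n) (Fin rc) ℝ)
    (Ld : Matrix (Fin n) (Fin rd) ℝ) : Prop :=
  ∀ t, RangeDwellTime Tmin Tmax t → ∀ Lc, IsTimerGain t Lt Lc →
  ∀ wc wcm wcp : ℝ → Fin pc → ℝ, (∀ s, 0 ≤ s → wcm s ≤ wc s ∧ wc s ≤ wcp s) →
  ∀ wd wdm wdp : ℕ → Fin pd → ℝ, (∀ k, wdm k ≤ wd k ∧ wd k ≤ wdp k) →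
  ∀ x xm xp ψ ψm ψp, P.IsStateTrajectory t wc wd x ψ →
    P.IsObserverTrajectory t Lc Ld (P.outputC wc x) (P.outputD t wd x ψ) wcm wdm xm ψm →
    P.IsObserverTrajectory t Lc Ld (P.outputC wc x) (P.outputD t wd x ψ) wcp wdp xp ψp →
    InitialDataLE P.hc P.hd xm ψm x ψ → InitialDataLE P.hc P.hd x ψ xp ψp →
      P.IsErrorTrajectory t Lc Ld (wcp - wc) (wdp - wd) (xp - x) (ψp - ψ) ∧
      P.IsErrorTrajectory t Lc Ld (wc - wcm) (wd - wdm) (x - xm) (ψ - ψm) ∧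
      ∀ s, 0 ≤ s → xm s ≤ x s ∧ x s ≤ xp s

end ImpulsiveDelaySystem

/-! The diagonal of `X` starts positive and never vanishes, so it stays positive and defines the
energy `∑ i, X (s - t k) i i * φ (e s i)`. The proof is a linear copositive Lyapunov argument for
this energy. The entrywise sign conditions let `φ` pass through the matrices of the error dynamics.
The conditions on `1ᵀ` are column sums: they say that the weighted energy, once the two delays are
accounted for, dissipates the performance outputs up to `γ` times the inputs. Delay terms are
handled by shifting integrals and sums, which costs only initial data.

One computation serves all claims, with `φ = skewAbs κ`. For `κ = 0`, `φ` is the negative part: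
nonnegative inputs and data then supply no energy, so the error stays nonnegative. This is the
interval observer property. For `κ = 1`, `φ` is the absolute value, which gives stability and the
gain.

Attractivity needs one more idea. Dissipation along the flow may be degenerate (`Mc` may vanish);
only `ε` at the jumps is strict, and it yields summability of `|e (t k)|`. Between impulses the
state is estimated backward in time. The bound `-α` on the diagonal prevents `φ (e i)` from
decreasing faster than exponentially, except at the expense of unused dissipation. The unused
amounts `S k` are also summable, so `e` on `(t k, t (k + 1)]` is controlled by `e (t (k + 1))` and
`S k`, both tending to zero. The pointwise step is `FlowCertificate.pointwise`, its integrated form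
`FlowCertificate.dissipation`, and the global inequality `IsTrajectory.dissipation`. -/

/-! ### Absolute continuity on an interval. -/

theorem AbsolutelyContinuousOnInterval.congr_eqOn {f g : ℝ → ℝ} {a b : ℝ}
    (hf : AbsolutelyContinuousOnInterval f a b) (hfg : EqOn f g (uIcc a b)) :
    AbsolutelyContinuousOnInterval g a b := by
  rw [absolutelyContinuousOnInterval_iff] at hf ⊢
  intro ε hε
  obtain ⟨δ, hδ, h⟩ := hf ε hε
  refine ⟨δ, hδ, fun E hE hl => ?_⟩
  refine lt_of_eq_of_lt (Finset.sum_congr rfl fun i hi => ?_) (h E hE hl)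
  have hm := hE.1 i hi
  rw [hfg hm.1, hfg hm.2]

theorem LipschitzWith.comp_absolutelyContinuousOnInterval {φ u : ℝ → ℝ} {K : NNReal} {a b : ℝ}
    (hφ : LipschitzWith K φ) (hu : AbsolutelyContinuousOnInterval u a b) :
    AbsolutelyContinuousOnInterval (fun s => φ (u s)) a b := by
  have h0 : Tendsto (fun E : ℕ × (ℕ → ℝ × ℝ) =>
      (K : ℝ) * ∑ i ∈ Finset.range E.1, dist (u (E.2 i).1) (u (E.2 i).2))
      (AbsolutelyContinuousOnInterval.totalLengthFilter ⊓
        𝓟 (AbsolutelyContinuousOnInterval.disjWithin a b)) (𝓝 0) := by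
    simpa using Tendsto.const_mul (K : ℝ) hu
  refine squeeze_zero (fun E => Finset.sum_nonneg fun _ _ => dist_nonneg) (fun E => ?_) h0
  rw [Finset.mul_sum]
  exact Finset.sum_le_sum fun i _ => hφ.dist_le_mul _ _

/-- A differentiable function whose derivative is bounded above is absolutely continuous. -/
theorem absolutelyContinuousOnInterval_of_deriv_le {g g' : ℝ → ℝ} {a b C : ℝ} (hab : a ≤ b)
    (hg : ∀ s ∈ Icc a b, HasDerivWithinAt g (g' s) (Icc a b) s) (hC : ∀ s ∈ Icc a b, g' s ≤ C) :
    AbsolutelyContinuousOnInterval g a b := by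
  have hcont : ContinuousOn g (Icc a b) := fun s hs => (hg s hs).continuousWithinAt
  have hd : ∀ s ∈ Ioo a b, HasDerivAt g (g' s) s := fun s hs =>
    (hg s (Ioo_subset_Icc_self hs)).hasDerivAt (Icc_mem_nhds hs.1 hs.2)
  -- `C - g'` is the nonnegative derivative of `C * s - g s`, hence integrable although `g'` itself
  -- carries no regularity assumption.
  have hint : IntervalIntegrable (fun s => C - g' s) volume a b := by
    rw [intervalIntegrable_iff_integrableOn_Ioc_of_le hab]
    refine intervalIntegral.integrableOn_deriv_of_nonneg (g := fun s => C * s - g s)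
      ((by fun_prop : Continuous fun s : ℝ => C * s).continuousOn.sub hcont)
      (fun s hs => ?_) (fun s hs => sub_nonneg.2 (hC s (Ioo_subset_Icc_self hs)))
    exact HasDerivAt.fun_sub (by simpa using (hasDerivAt_id s).const_mul C) (hd s hs)
  have hint' : IntervalIntegrable g' volume a b := by
    simpa using (intervalIntegrable_const (c := C)).sub hint
  have h1 := hint'.absolutelyContinuousOnInterval_intervalIntegral (c := a) (by simp)
  have h2 : AbsolutelyContinuousOnInterval (fun _ : ℝ => g a) a b :=
    (LipschitzWith.const (g a)).lipschitzOnWith.absolutelyContinuousOnInterval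
  refine (h2.add h1).congr_eqOn fun r hr => ?_
  rw [uIcc_of_le hab] at hr
  have := intervalIntegral.integral_eq_sub_of_hasDerivAt_of_le hr.1
    (hcont.mono (Icc_subset_Icc_right hr.2)) (fun s hs => hd s ⟨hs.1, hs.2.trans_le hr.2⟩)
    (hint'.mono_set (by rw [uIcc_of_le hr.1, uIcc_of_le hab]; exact Icc_subset_Icc_right hr.2))
  simp only [Pi.add_apply]
  linarith

theorem AbsolutelyContinuousOnInterval.finset_sum {ι : Type*} (s : Finset ι) {f : ι → ℝ → ℝ}
    {a b : ℝ} (hf : ∀ i ∈ s, AbsolutelyContinuousOnInterval (f i) a b) :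
    AbsolutelyContinuousOnInterval (fun r => ∑ i ∈ s, f i r) a b := by
  classical
  induction s using Finset.induction_on with
  | empty =>
    simpa using
      (LipschitzWith.const (α := ℝ) (0 : ℝ)).lipschitzOnWith.absolutelyContinuousOnInterval
  | insert i s hi ih =>
    simp only [Finset.sum_insert hi]
    exact (hf i (Finset.mem_insert_self i s)).fun_add
      (ih fun j hj => hf j (Finset.mem_insert_of_mem hj))

/-! ### The asymmetric absolute value and its chain rule. -/

/-- The asymmetric absolute value: `|x|` for `κ = 1`, the negative part of `x` for `κ = 0`. -/
noncomputable def skewAbs (κ x : ℝ) : ℝ := max (-x) (κ * x)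

/-- A subgradient of `skewAbs κ`. -/
noncomputable def skewSign (κ x : ℝ) : ℝ := if 0 < x then κ else if x < 0 then -1 else 0

theorem skewAbs_one (x : ℝ) : skewAbs 1 x = |x| := by
  rw [skewAbs, one_mul, max_comm]; rfl

theorem skewAbs_zero_right (κ : ℝ) : skewAbs κ 0 = 0 := by simp [skewAbs]

theorem skewAbs_nonneg {κ : ℝ} (hκ : 0 ≤ κ) (x : ℝ) : 0 ≤ skewAbs κ x := by
  rcases le_total 0 x with h | h
  · exact le_max_of_le_right (mul_nonneg hκ h)
  · exact le_max_of_le_left (by linarith)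

theorem skewAbs_zero_of_nonneg {x : ℝ} (hx : 0 ≤ x) : skewAbs 0 x = 0 := by
  simp [skewAbs, hx]

theorem nonneg_of_skewAbs_zero_le {x : ℝ} (hx : skewAbs 0 x ≤ 0) : 0 ≤ x := by
  have := le_max_left (-x) (0 * x)
  unfold skewAbs at hx
  linarith

theorem skewAbs_add_le {κ : ℝ} (x y : ℝ) :
    skewAbs κ (x + y) ≤ skewAbs κ x + skewAbs κ y := by
  refine max_le ?_ ?_
  · have := le_max_left (-x) (κ * x)
    have := le_max_left (-y) (κ * y)
    unfold skewAbs; linarith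
  · have := le_max_right (-x) (κ * x)
    have := le_max_right (-y) (κ * y)
    unfold skewAbs; linarith

theorem skewAbs_mul_of_nonneg {κ c : ℝ} (hc : 0 ≤ c) (x : ℝ) :
    skewAbs κ (c * x) = c * skewAbs κ x := by
  rw [skewAbs, skewAbs, mul_max_of_nonneg _ _ hc]
  congr 1 <;> ring

theorem skewAbs_sum_le {ι : Type*} (κ : ℝ) (s : Finset ι) (f : ι → ℝ) :
    skewAbs κ (∑ i ∈ s, f i) ≤ ∑ i ∈ s, skewAbs κ (f i) :=
  Finset.le_sum_of_subadditive _ (skewAbs_zero_right κ).le skewAbs_add_le s f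

theorem skewSign_mul_self {κ : ℝ} (hκ : 0 ≤ κ) (x : ℝ) : skewSign κ x * x = skewAbs κ x := by
  unfold skewSign skewAbs
  rcases lt_trichotomy 0 x with h | h | h
  · rw [if_pos h, max_eq_right]
    nlinarith
  · simp [← h]
  · rw [if_neg h.not_gt, if_pos h, max_eq_left, neg_one_mul]
    nlinarith

theorem skewSign_mul_le {κ : ℝ} (hκ : 0 ≤ κ) (x y : ℝ) : skewSign κ x * y ≤ skewAbs κ y := by
  unfold skewSign
  split_ifs
  · exact le_max_right _ _
  · rw [neg_one_mul]; exact le_max_left _ _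
  · rw [zero_mul]; exact skewAbs_nonneg hκ y

theorem lipschitzWith_skewAbs {κ : ℝ} (hκ : κ ∈ Icc (0 : ℝ) 1) : LipschitzWith 1 (skewAbs κ) := by
  have h2 : LipschitzWith 1 (fun x : ℝ => κ * x) := by
    refine LipschitzWith.of_dist_le_mul fun x y => ?_
    rw [Real.dist_eq, Real.dist_eq, ← mul_sub, abs_mul, abs_of_nonneg hκ.1]
    exact mul_le_mul_of_nonneg_right hκ.2 (abs_nonneg _)
  have h := (LipschitzWith.id (α := ℝ)).neg.max h2
  rw [max_self] at h
  exact h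

theorem continuous_skewAbs (κ : ℝ) : Continuous (skewAbs κ) := by
  unfold skewAbs; fun_prop

theorem hasDerivAt_skewAbs {κ x : ℝ} (hκ : 0 ≤ κ) (hx : x ≠ 0) :
    HasDerivAt (skewAbs κ) (skewSign κ x) x := by
  rcases hx.lt_or_gt with h | h
  · have : skewSign κ x = -1 := by simp [skewSign, h, h.not_gt]
    rw [this]
    refine (hasDerivAt_neg x).congr_of_eventuallyEq ?_
    filter_upwards [Iio_mem_nhds h] with y hy
    exact max_eq_left (by nlinarith [mem_Iio.1 hy])
  · have : skewSign κ x = κ := by simp [skewSign, h]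
    rw [this]
    have h1 : HasDerivAt (fun y : ℝ => κ * y) κ x := by
      simpa using (hasDerivAt_id x).const_mul κ
    refine h1.congr_of_eventuallyEq ?_
    filter_upwards [Ioi_mem_nhds h] with y hy
    exact max_eq_right (by nlinarith [mem_Ioi.1 hy])

/-- Where both sides are differentiable, `skewAbs κ ∘ u` has derivative `skewSign κ (u s) * u'`. -/
theorem HasDerivAt.skewAbs_comp {κ u' s : ℝ} {u : ℝ → ℝ} (hκ : 0 ≤ κ) (hu : HasDerivAt u u' s)
    (hd : DifferentiableAt ℝ (fun r => skewAbs κ (u r)) s) :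
    HasDerivAt (fun r => skewAbs κ (u r)) (skewSign κ (u s) * u') s := by
  by_cases h : u s = 0
  -- At a zero of `u` the nonnegative composite has a minimum, so its derivative vanishes. This is
  -- why `skewSign κ 0` is set to `0`.
  · have h0 : _root_.deriv (fun r => skewAbs κ (u r)) s = 0 := by
      refine IsLocalMin.deriv_eq_zero (Filter.Eventually.of_forall fun r => ?_)
      simp only [h, skewAbs_zero_right]
      exact skewAbs_nonneg hκ _
    have := hd.hasDerivAt
    rw [h0] at this
    simpa [h, skewSign] using this
  · exact (hasDerivAt_skewAbs hκ h).comp s hu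

/-! ### Dissipation on one flow interval. -/

/-- Data certifying dissipation of the weighted `1`-norm along flows
`x (τ) ∘ u' = B (τ) u + D (τ) v + E (τ) δ` on `[0, T]`. -/
structure FlowCertificate {n p : ℕ} (T : ℝ) (x xd : ℝ → Fin n → ℝ)
    (B D : ℝ → Matrix (Fin n) (Fin n) ℝ) (E : ℝ → Matrix (Fin n) (Fin p) ℝ)
    (μ q : Fin n → ℝ) (α γ : ℝ) : Prop where
  hasDeriv : ∀ τ ∈ Icc 0 T, ∀ i, HasDerivWithinAt (fun s => x s i) (xd τ i) (Icc 0 T) τ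
  weight_pos : ∀ τ ∈ Icc 0 T, ∀ i, 0 < x τ i
  alpha_pos : 0 < α
  delay_weight_nonneg : ∀ i, 0 ≤ μ i
  output_weight_nonneg : ∀ i, 0 ≤ q i
  offDiag : ∀ τ ∈ Icc 0 T, ∀ i j, i ≠ j → 0 ≤ B τ i j
  diag : ∀ τ ∈ Icc 0 T, ∀ i, -α ≤ B τ i i
  delay : ∀ τ ∈ Icc 0 T, EntrywiseNonneg (D τ)
  input : ∀ τ ∈ Icc 0 T, EntrywiseNonneg (E τ)
  column : ∀ τ ∈ Icc 0 T, ∀ j, xd τ j + ∑ i, B τ i j + μ j + q j ≤ 0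
  column_delay : ∀ τ ∈ Icc 0 T, ∀ j, ∑ i, D τ i j ≤ μ j
  column_input : ∀ τ ∈ Icc 0 T, ∀ j, ∑ i, E τ i j ≤ γ

namespace FlowCertificate

variable {n p : ℕ} {T : ℝ} {x xd : ℝ → Fin n → ℝ} {B D : ℝ → Matrix (Fin n) (Fin n) ℝ}
  {E : ℝ → Matrix (Fin n) (Fin p) ℝ} {μ q : Fin n → ℝ} {α γ κ : ℝ}

/-- Every column sum of `B` is at least `-α`, so the column condition caps `xd`. This one-sided
bound is what makes the merely differentiable weights absolutely continuous. -/
theorem deriv_le (H : FlowCertificate T x xd B D E μ q α γ) {τ : ℝ} (hτ : τ ∈ Icc 0 T)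
    (j : Fin n) : xd τ j ≤ α := by
  have h1 : -α ≤ ∑ i, B τ i j := by
    rw [← Finset.add_sum_erase _ _ (Finset.mem_univ j)]
    have := Finset.sum_nonneg fun i (hi : i ∈ Finset.univ.erase j) =>
      H.offDiag τ hτ i j (Finset.ne_of_mem_erase hi)
    linarith [H.diag τ hτ j]
  linarith [H.column τ hτ j, H.delay_weight_nonneg j, H.output_weight_nonneg j]

/-- The pointwise supply of the dissipation inequality. -/
noncomputable def supply (μ q : Fin n → ℝ) (γ κ : ℝ) (u v : Fin n → ℝ) (δ : Fin p → ℝ) : ℝ :=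
  ∑ j, μ j * skewAbs κ (v j) + γ * ∑ j, skewAbs κ (δ j) - ∑ j, (μ j + q j) * skewAbs κ (u j)

/-- `F` stands for the weighted derivative `x ∘ u'`. By the sign conditions, row `i` satisfies
`skewSign κ (u i) * F i ≤ b i`, and the column conditions bound the sum of the `b i`. The row gaps
are nonnegative and add up to at most the slack, so each single gap is at most the slack. Combined
with `b i ≥ -α * skewAbs κ (u i)`, this bounds the rate of decrease of each component. -/
theorem pointwise (H : FlowCertificate T x xd B D E μ q α γ) (hκ : 0 ≤ κ) {τ : ℝ}
    (hτ : τ ∈ Icc 0 T) (u v : Fin n → ℝ) (δ : Fin p → ℝ) {F : Fin n → ℝ}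
    (hF : F = B τ *ᵥ u + D τ *ᵥ v + E τ *ᵥ δ) :
    0 ≤ supply μ q γ κ u v δ - ∑ i, (xd τ i * skewAbs κ (u i) + skewSign κ (u i) * F i) ∧
    ∀ i, -(α * skewAbs κ (u i)) - skewSign κ (u i) * F i ≤
      supply μ q γ κ u v δ - ∑ i, (xd τ i * skewAbs κ (u i) + skewSign κ (u i) * F i) := by
  set b : Fin n → ℝ := fun i => ∑ j, B τ i j * skewAbs κ (u j) +
    ∑ j, D τ i j * skewAbs κ (v j) + ∑ j, E τ i j * skewAbs κ (δ j) with hb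
  have hφ := fun z : ℝ => skewAbs_nonneg hκ z
  have hle : ∀ i, skewSign κ (u i) * F i ≤ b i := fun i => by
    simp only [hF, Pi.add_apply, mulVec, dotProduct, mul_add, Finset.mul_sum, hb]
    refine add_le_add (add_le_add ?_ ?_) ?_ <;> refine Finset.sum_le_sum fun j _ => ?_
    · rw [mul_left_comm]
      by_cases hij : i = j
      · rw [← hij, skewSign_mul_self hκ]
      · exact mul_le_mul_of_nonneg_left (skewSign_mul_le hκ _ _) (H.offDiag τ hτ i j hij)
    · rw [mul_left_comm]
      exact mul_le_mul_of_nonneg_left (skewSign_mul_le hκ _ _) (H.delay τ hτ i j)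
    · rw [mul_left_comm]
      exact mul_le_mul_of_nonneg_left (skewSign_mul_le hκ _ _) (H.input τ hτ i j)
  have hlow : ∀ i, -(α * skewAbs κ (u i)) ≤ b i := fun i => by
    have h1 : -(α * skewAbs κ (u i)) ≤ ∑ j, B τ i j * skewAbs κ (u j) := by
      rw [← Finset.add_sum_erase _ _ (Finset.mem_univ i)]
      have := Finset.sum_nonneg fun j (hj : j ∈ Finset.univ.erase i) =>
        mul_nonneg (H.offDiag τ hτ i j (Finset.ne_of_mem_erase hj).symm) (hφ (u j))
      have := mul_le_mul_of_nonneg_right (H.diag τ hτ i) (hφ (u i))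
      linarith
    have h2 : 0 ≤ ∑ j, D τ i j * skewAbs κ (v j) :=
      Finset.sum_nonneg fun j _ => mul_nonneg (H.delay τ hτ i j) (hφ _)
    have h3 : 0 ≤ ∑ j, E τ i j * skewAbs κ (δ j) :=
      Finset.sum_nonneg fun j _ => mul_nonneg (H.input τ hτ i j) (hφ _)
    simp only [hb]
    linarith
  have hsum : ∑ i, b i + ∑ i, xd τ i * skewAbs κ (u i) ≤ supply μ q γ κ u v δ := by
    simp only [hb, Finset.sum_add_distrib, supply]
    rw [Finset.sum_comm, Finset.sum_comm (f := fun i j => D τ i j * skewAbs κ (v j)),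
      Finset.sum_comm (f := fun i j => E τ i j * skewAbs κ (δ j))]
    simp only [← Finset.sum_mul]
    have h1 : ∑ j, (∑ i, B τ i j) * skewAbs κ (u j) + ∑ j, xd τ j * skewAbs κ (u j) +
        ∑ j, (μ j + q j) * skewAbs κ (u j) ≤ 0 := by
      rw [← Finset.sum_add_distrib, ← Finset.sum_add_distrib]
      refine Finset.sum_nonpos fun j _ => ?_
      have := mul_nonneg (neg_nonneg.2 (H.column τ hτ j)) (hφ (u j))
      linarith
    have h2 : ∑ j, (∑ i, D τ i j) * skewAbs κ (v j) ≤ ∑ j, μ j * skewAbs κ (v j) :=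
      Finset.sum_le_sum fun j _ => mul_le_mul_of_nonneg_right (H.column_delay τ hτ j) (hφ _)
    have h3 : ∑ j, (∑ i, E τ i j) * skewAbs κ (δ j) ≤ γ * ∑ j, skewAbs κ (δ j) := by
      rw [Finset.mul_sum]
      exact Finset.sum_le_sum fun j _ => mul_le_mul_of_nonneg_right (H.column_input τ hτ j) (hφ _)
    linarith
  rw [Finset.sum_add_distrib]
  have hgap : ∀ i, 0 ≤ b i - skewSign κ (u i) * F i := fun i => sub_nonneg.2 (hle i)
  have htot : ∑ i, (b i - skewSign κ (u i) * F i) ≤ supply μ q γ κ u v δ -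
      (∑ i, xd τ i * skewAbs κ (u i) + ∑ i, skewSign κ (u i) * F i) := by
    rw [Finset.sum_sub_distrib]; linarith
  refine ⟨(Finset.sum_nonneg fun i _ => hgap i).trans htot, fun i => ?_⟩
  have := Finset.single_le_sum (fun i _ => hgap i) (Finset.mem_univ i)
  linarith [hlow i]

end FlowCertificate

namespace FlowCertificate

variable {n p : ℕ} {T : ℝ} {x xd : ℝ → Fin n → ℝ} {B D : ℝ → Matrix (Fin n) (Fin n) ℝ}
  {E : ℝ → Matrix (Fin n) (Fin p) ℝ} {μ q : Fin n → ℝ} {α γ κ : ℝ}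

theorem intervalIntegrable_supply {a b : ℝ} {u v : ℝ → Fin n → ℝ} {δ : ℝ → Fin p → ℝ}
    (hu : ∀ j, IntervalIntegrable (fun s => skewAbs κ (u s j)) volume a b)
    (hv : ∀ j, IntervalIntegrable (fun s => skewAbs κ (v s j)) volume a b)
    (hδ : ∀ j, IntervalIntegrable (fun s => skewAbs κ (δ s j)) volume a b) :
    IntervalIntegrable (fun s => supply μ q γ κ (u s) (v s) (δ s)) volume a b := by
  have h1 := IntervalIntegrable.sum Finset.univ fun j _ => (hv j).const_mul (μ j)
  have h2 := (IntervalIntegrable.sum Finset.univ fun j _ => hδ j).const_mul γ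
  have h3 := IntervalIntegrable.sum Finset.univ fun j _ => (hu j).const_mul (μ j + q j)
  refine ((h1.add h2).sub h3).congr fun s _ => ?_
  simp [supply, Finset.sum_apply]

/-- `S` is the integral of the slack in the pointwise inequality, so the energy balance is an
identity. The last claim is Grönwall's inequality run backward from `b`: the delayed state does not
enter it, whereas a forward estimate would involve it. -/
theorem dissipation (H : FlowCertificate T x xd B D E μ q α γ) (hκ : κ ∈ Icc (0 : ℝ) 1)
    {a b c : ℝ} (hab : a < b) (hbT : b - a ≤ T) (hc : 0 < c)
    (hcx : ∀ τ ∈ Icc 0 T, ∀ i, c ≤ x τ i)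
    {u f v : ℝ → Fin n → ℝ} {δ : ℝ → Fin p → ℝ}
    (hf : ∀ i, IntervalIntegrable (fun s => f s i) volume a b)
    (hu : ∀ r ∈ Icc a b, ∀ i, u r i = u a i + ∫ s in a..r, f s i)
    (hfl : ∀ s ∈ Ioc a b, ∀ i, x (s - a) i * f s i =
      (B (s - a) *ᵥ u s + D (s - a) *ᵥ v s + E (s - a) *ᵥ δ s) i)
    (hv : ∀ j, IntervalIntegrable (fun s => skewAbs κ (v s j)) volume a b)
    (hδ : ∀ j, IntervalIntegrable (fun s => skewAbs κ (δ s j)) volume a b) :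
    ∃ S, 0 ≤ S ∧
      ∑ i, x (b - a) i * skewAbs κ (u b i) + S = ∑ i, x 0 i * skewAbs κ (u a i) +
        ∫ s in a..b, supply μ q γ κ (u s) (v s) (δ s) ∧
      ∀ r ∈ Icc a b, ∀ i,
        skewAbs κ (u r i) ≤ Real.exp (α / c * T) * (skewAbs κ (u b i) + S / c) := by
  have hu_ac : ∀ i, AbsolutelyContinuousOnInterval (fun s => u s i) a b := fun i => by
    refine AbsolutelyContinuousOnInterval.congr_eqOn
      (((LipschitzWith.const (u a i)).lipschitzOnWith.absolutelyContinuousOnInterval).add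
        ((hf i).absolutelyContinuousOnInterval_intervalIntegral (c := a) (by simp)))
      fun r hr => ?_
    rw [uIcc_of_le hab.le] at hr
    exact (hu r hr i).symm
  have hw_ac : ∀ i, AbsolutelyContinuousOnInterval (fun s => skewAbs κ (u s i)) a b := fun i =>
    (lipschitzWith_skewAbs hκ).comp_absolutelyContinuousOnInterval (hu_ac i)
  have hmem : ∀ s ∈ Icc a b, s - a ∈ Icc 0 T := fun s hs =>
    ⟨sub_nonneg.2 hs.1, (sub_le_sub_right hs.2 a).trans hbT⟩
  have hx_deriv : ∀ i, ∀ s ∈ Icc a b,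
      HasDerivWithinAt (fun r => x (r - a) i) (xd (s - a) i) (Icc a b) s := fun i s hs => by
    have h := (H.hasDeriv (s - a) (hmem s hs) i).comp s
      ((hasDerivAt_id s).sub_const a).hasDerivWithinAt hmem
    rw [mul_one] at h
    exact h
  have hx_ac : ∀ i, AbsolutelyContinuousOnInterval (fun s => x (s - a) i) a b := fun i =>
    absolutelyContinuousOnInterval_of_deriv_le hab.le (hx_deriv i)
      fun s hs => H.deriv_le (hmem s hs) i
  set W : ℝ → ℝ := fun s => ∑ i, x (s - a) i * skewAbs κ (u s i) with hW
  have hW_ac : AbsolutelyContinuousOnInterval W a b :=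
    AbsolutelyContinuousOnInterval.finset_sum _ fun i _ => (hx_ac i).fun_mul (hw_ac i)
  set σ : ℝ → ℝ := fun s => supply μ q γ κ (u s) (v s) (δ s) - deriv W s with hσ
  have hsup : IntervalIntegrable (fun s => supply μ q γ κ (u s) (v s) (δ s)) volume a b :=
    intervalIntegrable_supply (fun j => (hw_ac j).continuousOn.intervalIntegrable) hv hδ
  have hσ_int : IntervalIntegrable σ volume a b := hsup.sub hW_ac.intervalIntegrable_deriv
  have hae : ∀ᵐ s, s ∈ Ioc a b → 0 ≤ σ s ∧ ∀ i, ∃ d,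
      HasDerivAt (fun r => skewAbs κ (u r i)) d s ∧
      -(α / c * skewAbs κ (u s i)) - σ s / c ≤ d := by
    have h1 : ∀ᵐ s, ∀ i, s ∈ uIcc a b →
        DifferentiableAt ℝ (fun r => skewAbs κ (u r i)) s :=
      ae_all_iff.2 fun i => (hw_ac i).ae_differentiableAt
    have h2 := ae_all_iff.2 fun i => (hf i).ae_hasDerivAt_integral
    have h3 : ∀ᵐ s : ℝ, s ≠ b := by simp [ae_iff, measure_singleton]
    filter_upwards [h1, h2, h3] with s h1 h2 h3 hs
    have hsoo : s ∈ Ioo a b := ⟨hs.1, lt_of_le_of_ne hs.2 h3⟩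
    have hscc : s ∈ Icc a b := Ioo_subset_Icc_self hsoo
    have hsu : s ∈ uIcc a b := by rwa [uIcc_of_le hab.le]
    have hud : ∀ i, HasDerivAt (fun r => u r i) (f s i) s := fun i => by
      refine ((h2 i hsu a (by simp)).const_add (u a i)).congr_of_eventuallyEq ?_
      filter_upwards [Icc_mem_nhds hsoo.1 hsoo.2] with r hr using hu r hr i
    have hwd : ∀ i, HasDerivAt (fun r => skewAbs κ (u r i)) (skewSign κ (u s i) * f s i) s :=
      fun i => (hud i).skewAbs_comp hκ.1 (h1 i hsu)
    have hxd : ∀ i, HasDerivAt (fun r => x (r - a) i) (xd (s - a) i) s := fun i =>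
      (hx_deriv i s hscc).hasDerivAt (Icc_mem_nhds hsoo.1 hsoo.2)
    have hWd : deriv W s = ∑ i, (xd (s - a) i * skewAbs κ (u s i) +
        skewSign κ (u s i) * (x (s - a) i * f s i)) := by
      have : HasDerivAt W (∑ i, (xd (s - a) i * skewAbs κ (u s i) +
          x (s - a) i * (skewSign κ (u s i) * f s i))) s :=
        HasDerivAt.fun_sum fun i _ => (hxd i).fun_mul (hwd i)
      rw [this.deriv]
      exact Finset.sum_congr rfl fun i _ => by ring
    obtain ⟨hp1, hp2⟩ := H.pointwise hκ.1 (hmem s hscc) (u s) (v s) (δ s)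
      (F := fun i => x (s - a) i * f s i) (funext fun i => hfl s hs i)
    have hσs : σ s = supply μ q γ κ (u s) (v s) (δ s) - ∑ i, (xd (s - a) i * skewAbs κ (u s i) +
        skewSign κ (u s i) * (x (s - a) i * f s i)) := by simp only [hσ, hWd]
    rw [← hσs] at hp1 hp2
    refine ⟨hp1, fun i => ⟨_, hwd i, ?_⟩⟩
    have hxc := hcx _ (hmem s hscc) i
    have hk : -(α * skewAbs κ (u s i) + σ s) ≤
        x (s - a) i * (skewSign κ (u s i) * f s i) := by
      have := hp2 i
      linarith [mul_left_comm (x (s - a) i) (skewSign κ (u s i)) (f s i)]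
    have hnn : 0 ≤ α * skewAbs κ (u s i) + σ s :=
      add_nonneg (mul_nonneg H.alpha_pos.le (skewAbs_nonneg hκ.1 _)) hp1
    have hgoal : -(α / c * skewAbs κ (u s i)) - σ s / c =
        -((α * skewAbs κ (u s i) + σ s) / c) := by field_simp; ring
    rw [hgoal, neg_le, le_div_iff₀ hc]
    -- The bound concerns the weighted derivative. If the derivative is negative, replacing the
    -- weight by its lower bound `c` only helps; otherwise there is nothing to prove.
    rcases le_total 0 (skewSign κ (u s i) * f s i) with h | h
    · nlinarith
    · nlinarith
  have hσ_nonneg : ∀ r₁ ∈ Icc a b, ∀ r₂ ∈ Icc a b, r₁ ≤ r₂ → 0 ≤ ∫ s in r₁..r₂, σ s := by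
    intro r₁ h₁ r₂ h₂ h
    refine intervalIntegral.integral_nonneg_of_ae_restrict h ?_
    refine (ae_restrict_iff' measurableSet_Icc).2 ?_
    have h3 : ∀ᵐ s : ℝ, s ≠ a := by simp [ae_iff, measure_singleton]
    filter_upwards [hae, h3] with s hs hsa hm
    exact (hs ⟨lt_of_le_of_ne (h₁.1.trans hm.1) hsa.symm, hm.2.trans h₂.2⟩).1
  refine ⟨∫ s in a..b, σ s, hσ_nonneg a (left_mem_Icc.2 hab.le) b (right_mem_Icc.2 hab.le) hab.le,
    ?_, fun r hr i => ?_⟩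
  · rw [hσ, intervalIntegral.integral_sub hsup hW_ac.intervalIntegrable_deriv,
      hW_ac.integral_deriv_eq_sub]
    simp only [hW, sub_self]
    ring
  · set l := α / c with hl
    have hlpos : 0 < l := div_pos H.alpha_pos hc
    -- The integrating factor cancels the term `-l * skewAbs κ (u s i)`, leaving `deriv g ≥ -(exp (l
    -- * T) / c) * σ` almost everywhere.
    set g : ℝ → ℝ := fun s => Real.exp (l * (s - r)) * skewAbs κ (u s i) with hg
    have hrb : uIcc r b ⊆ uIcc a b := by
      rw [uIcc_of_le hr.2, uIcc_of_le hab.le]; exact Icc_subset_Icc_left hr.1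
    have hg_ac : AbsolutelyContinuousOnInterval g r b :=
      AbsolutelyContinuousOnInterval.fun_mul
        (ContDiffOn.absolutelyContinuousOnInterval
          (Real.contDiff_exp.comp (by fun_prop)).contDiffOn)
        ((hw_ac i).mono hrb)
    have hσ_int' := hσ_int.mono_set hrb
    have hge : ∫ s in r..b, -(Real.exp (l * T) / c) * σ s ≤ ∫ s in r..b, deriv g s := by
      refine intervalIntegral.integral_mono_ae_restrict hr.2 (hσ_int'.const_mul _)
        hg_ac.intervalIntegrable_deriv ((ae_restrict_iff' measurableSet_Icc).2 ?_)
      have h3 : ∀ᵐ s : ℝ, s ≠ a := by simp [ae_iff, measure_singleton]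
      filter_upwards [hae, h3] with s hs hsa hm
      obtain ⟨h0, hi⟩ := hs ⟨lt_of_le_of_ne (hr.1.trans hm.1) hsa.symm, hm.2⟩
      obtain ⟨d, hd, hdl⟩ := hi i
      have he : HasDerivAt (fun s => Real.exp (l * (s - r))) (Real.exp (l * (s - r)) * l) s := by
        simpa using (((hasDerivAt_id s).sub_const r).const_mul l).exp
      rw [hg, (he.fun_mul hd).deriv]
      have hexp : Real.exp (l * (s - r)) ≤ Real.exp (l * T) := by
        refine Real.exp_le_exp.2 (mul_le_mul_of_nonneg_left ?_ hlpos.le)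
        linarith [hr.1, hm.2]
      have h4 : Real.exp (l * (s - r)) * (-(l * skewAbs κ (u s i)) - σ s / c) ≤
          Real.exp (l * (s - r)) * d := mul_le_mul_of_nonneg_left hdl (Real.exp_pos _).le
      have h5 : Real.exp (l * (s - r)) * (σ s / c) ≤ Real.exp (l * T) * (σ s / c) :=
        mul_le_mul_of_nonneg_right hexp (div_nonneg h0 hc.le)
      have h6 : -(Real.exp (l * T) / c) * σ s = -(Real.exp (l * T) * (σ s / c)) := by ring
      rw [h6]
      linarith
    rw [hg_ac.integral_deriv_eq_sub, intervalIntegral.integral_const_mul] at hge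
    have hsub : ∫ s in r..b, σ s ≤ ∫ s in a..b, σ s := by
      have har : uIcc a r ⊆ uIcc a b := by
        rw [uIcc_of_le hr.1, uIcc_of_le hab.le]; exact Icc_subset_Icc_right hr.2
      rw [← intervalIntegral.integral_add_adjacent_intervals (hσ_int.mono_set har) hσ_int']
      linarith [hσ_nonneg a (left_mem_Icc.2 hab.le) r hr hr.1]
    have hgr : g r = skewAbs κ (u r i) := by simp [hg]
    have hgb : g b ≤ Real.exp (l * T) * skewAbs κ (u b i) := by
      refine mul_le_mul_of_nonneg_right (Real.exp_le_exp.2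
        (mul_le_mul_of_nonneg_left ?_ hlpos.le)) (skewAbs_nonneg hκ.1 _)
      linarith [hr.1]
    have h7 : Real.exp (l * T) / c * ∫ s in r..b, σ s ≤ Real.exp (l * T) / c * ∫ s in a..b, σ s :=
      mul_le_mul_of_nonneg_left hsub (div_nonneg (Real.exp_pos _).le hc.le)
    have h8 : Real.exp (l * T) * (skewAbs κ (u b i) + (∫ s in a..b, σ s) / c) =
      Real.exp (l * T) * skewAbs κ (u b i) + Real.exp (l * T) / c * ∫ s in a..b, σ s := by ring
    rw [h8]
    linarith

end FlowCertificate

/-! ### Impulse times and trajectories between impulses. -/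

theorem RangeDwellTime.monotone {Tmin Tmax : ℝ} {t : ℕ → ℝ} (ht : RangeDwellTime Tmin Tmax t) :
    Monotone t :=
  monotone_nat_of_le_succ fun k => (ht.lt_succ k).le

theorem RangeDwellTime.nonneg {Tmin Tmax : ℝ} {t : ℕ → ℝ} (ht : RangeDwellTime Tmin Tmax t)
    (k : ℕ) : 0 ≤ t k :=
  ht.zero ▸ ht.monotone (Nat.zero_le k)

theorem RangeDwellTime.exists_mem_Ioc {Tmin Tmax : ℝ} {t : ℕ → ℝ}
    (ht : RangeDwellTime Tmin Tmax t) {r : ℝ} (hr : 0 < r) : ∃ k, r ∈ Ioc (t k) (t (k + 1)) := by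
  have hex : ∃ k, r ≤ t (k + 1) :=
    (((tendsto_add_atTop_iff_nat 1).2 ht.tendsto).eventually_ge_atTop r).exists
  classical
  refine ⟨Nat.find hex, ?_, Nat.find_spec hex⟩
  rcases h : Nat.find hex with _ | m
  · rwa [ht.zero]
  · exact not_le.1 (Nat.find_min hex (by omega : m < Nat.find hex))

section Trajectory

variable {n : ℕ} {hc : ℝ} {hd : ℕ} {t : ℕ → ℝ}
  {flow : ℝ → (Fin n → ℝ) → (Fin n → ℝ) → (Fin n → ℝ)}
  {jump : ℕ → (Fin n → ℝ) → (Fin n → ℝ) → (Fin n → ℝ)}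
  {e : ℝ → Fin n → ℝ} {ψ : ℤ → Fin n → ℝ}

/-- At `t k` the trajectory holds its value before the jump. Replacing it there by the value after
the jump gives a continuous solution on the closed interval. -/
theorem IsTrajectory.exists_continuousOn_eqOn (h : IsTrajectory hc hd t flow jump e ψ) {k : ℕ}
    (hk : t k ≤ t (k + 1)) :
    ∃ u : ℝ → Fin n → ℝ, ContinuousOn u (Icc (t k) (t (k + 1))) ∧
      EqOn e u (Ioc (t k) (t (k + 1))) ∧ u (t k) = postJumpState hd t jump e ψ k ∧
      ∀ r ∈ Icc (t k) (t (k + 1)), u r = u (t k) + ∫ s in (t k)..r, flow s (e s) (e (s - hc)) := by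
  refine ⟨fun r => postJumpState hd t jump e ψ k + ∫ s in (t k)..r, flow s (e s) (e (s - hc)),
    ?_, fun r hr => h.integral_eq k r hr, by simp, fun r _ => by simp⟩
  refine continuousOn_const.add ?_
  have := intervalIntegral.continuousOn_primitive_interval (μ := volume) (a := t k) (b := t (k + 1))
    (f := fun s => flow s (e s) (e (s - hc)))
    (by rw [uIcc_of_le hk]; exact (integrableOn_Icc_iff_integrableOn_Ioc).2 (h.integrable k))
  rwa [uIcc_of_le hk] at this

theorem IsTrajectory.intervalIntegrable_comp {Tmin Tmax : ℝ} (ht : RangeDwellTime Tmin Tmax t)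
    (h : IsTrajectory hc hd t flow jump e ψ) (hhc : 0 < hc) {g : (Fin n → ℝ) → ℝ}
    (hg : Continuous g) {a b : ℝ} (ha : -hc ≤ a) (hb : -hc ≤ b) :
    IntervalIntegrable (fun s => g (e s)) volume a b := by
  have h0 : IntervalIntegrable (fun s => g (e s)) volume (-hc) (t 0) := by
    rw [ht.zero]
    refine ContinuousOn.intervalIntegrable ?_
    rw [uIcc_of_le (by linarith)]
    exact hg.comp_continuousOn h.initial_continuous
  have hstep : ∀ k, IntervalIntegrable (fun s => g (e s)) volume (t k) (t (k + 1)) := fun k => by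
    obtain ⟨u, hu, heq, -⟩ := h.exists_continuousOn_eqOn (ht.lt_succ k).le
    have : IntervalIntegrable (fun s => g (u s)) volume (t k) (t (k + 1)) := by
      refine ContinuousOn.intervalIntegrable ?_
      rw [uIcc_of_le (ht.lt_succ k).le]
      exact hg.comp_continuousOn hu
    refine this.congr fun s hs => ?_
    rw [uIoc_of_le (ht.lt_succ k).le] at hs
    simp only [heq hs]
  have hk : ∀ k, IntervalIntegrable (fun s => g (e s)) volume (-hc) (t k) := fun k => by
    induction k with
    | zero => exact h0
    | succ k ih => exact ih.trans (hstep k)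
  obtain ⟨k, hk'⟩ := (ht.tendsto.eventually_ge_atTop (max a b)).exists
  refine (hk k).mono_set ?_
  rw [uIcc_of_le (ha.trans ((le_max_left a b).trans hk'))]
  exact uIcc_subset_Icc ⟨ha, (le_max_left a b).trans hk'⟩ ⟨hb, (le_max_right a b).trans hk'⟩

theorem IsTrajectory.flow_dissipation {p : ℕ} {Tmin Tmax : ℝ} {x xd : ℝ → Fin n → ℝ}
    {B D : ℝ → Matrix (Fin n) (Fin n) ℝ} {E : ℝ → Matrix (Fin n) (Fin p) ℝ} {μ q : Fin n → ℝ}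
    {α γ κ c : ℝ} {δ : ℝ → Fin p → ℝ} (ht : RangeDwellTime Tmin Tmax t)
    (h : IsTrajectory hc hd t flow jump e ψ) (hhc : 0 < hc)
    (H : FlowCertificate Tmax x xd B D E μ q α γ) (hκ : κ ∈ Icc (0 : ℝ) 1)
    (hc0 : 0 < c) (hcx : ∀ τ ∈ Icc 0 Tmax, ∀ i, c ≤ x τ i)
    (hfl : ∀ k, ∀ s ∈ Ioc (t k) (t (k + 1)), ∀ i, x (s - t k) i * flow s (e s) (e (s - hc)) i =
      (B (s - t k) *ᵥ e s + D (s - t k) *ᵥ e (s - hc) + E (s - t k) *ᵥ δ s) i)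
    (hδ : ∀ r, 0 ≤ r → ∀ j, IntervalIntegrable (fun s => skewAbs κ (δ s j)) volume 0 r)
    (k : ℕ) {b : ℝ} (hb : b ∈ Ioc (t k) (t (k + 1))) :
    ∃ S, 0 ≤ S ∧
      ∑ i, x (b - t k) i * skewAbs κ (e b i) + S =
        ∑ i, x 0 i * skewAbs κ (postJumpState hd t jump e ψ k i) +
        ∫ s in (t k)..b, FlowCertificate.supply μ q γ κ (e s) (e (s - hc)) (δ s) ∧
      ∀ r ∈ Ioc (t k) b, ∀ i,
        skewAbs κ (e r i) ≤ Real.exp (α / c * Tmax) * (skewAbs κ (e b i) + S / c) := by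
  obtain ⟨u, -, heq, hpost, hu⟩ := h.exists_continuousOn_eqOn (ht.lt_succ k).le
  have hsub : Ioc (t k) b ⊆ Ioc (t k) (t (k + 1)) := Ioc_subset_Ioc_right hb.2
  have hfi : IntervalIntegrable (fun s => flow s (e s) (e (s - hc))) volume (t k) b := by
    rw [intervalIntegrable_iff_integrableOn_Ioc_of_le hb.1.le]
    exact (h.integrable k).mono_set hsub
  have hfi' : ∀ i, IntervalIntegrable (fun s => flow s (e s) (e (s - hc)) i) volume (t k) b :=
    fun i => by
      rw [intervalIntegrable_iff] at hfi ⊢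
      exact hfi.eval i
  have h0 := ht.nonneg k
  obtain ⟨S, hS, hEq, hLow⟩ := H.dissipation hκ hb.1
    ((sub_le_sub_right hb.2 _).trans (ht.dwell_mem k).2) hc0 hcx (u := u)
    (f := fun s => flow s (e s) (e (s - hc))) (v := fun s => e (s - hc)) (δ := δ) hfi'
    (fun r hr i => by
      have hr' : uIcc (t k) r ⊆ uIcc (t k) b := by
        rw [uIcc_of_le hr.1, uIcc_of_le hb.1.le]; exact Icc_subset_Icc_right hr.2
      rw [hu r ⟨hr.1, hr.2.trans hb.2⟩, Pi.add_apply]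
      congr 1
      have hfr := hfi.mono_set hr'
      rw [intervalIntegral.integral_of_le hr.1, intervalIntegral.integral_of_le hr.1]
      exact eval_integral (fun i => (intervalIntegrable_iff_integrableOn_Ioc_of_le hr.1).1
        ((hfi' i).mono_set hr')) i)
    (fun s hs i => by rw [← heq (hsub hs)]; exact hfl k s (hsub hs) i)
    (fun j => by
      have := h.intervalIntegrable_comp ht hhc
        ((continuous_skewAbs κ).comp (continuous_apply j)) (a := t k - hc) (b := b - hc)
        (by linarith) (by linarith [hb.1])
      simpa using this.comp_sub_right hc)
    (fun j => (hδ b (h0.trans hb.1.le) j).mono_set (by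
      rw [uIcc_of_le hb.1.le, uIcc_of_le (h0.trans hb.1.le)]; exact Icc_subset_Icc_left h0))
  refine ⟨S, hS, ?_, fun r hr i => ?_⟩
  · rw [heq hb, hEq, hpost]
    congr 1
    refine intervalIntegral.integral_congr_ae (ae_of_all _ fun s hs => ?_)
    rw [uIoc_of_le hb.1.le] at hs
    rw [heq (hsub hs)]
  · have := hLow r (Ioc_subset_Icc_self hr) i
    rwa [← heq (hsub hr), ← heq hb] at this

end Trajectory

/-! ### Dissipation across jumps. -/

/-- Data certifying dissipation of the weighted `1`-norm across jumps
`x (0) ∘ z = B u + D v + E δ` that follow a dwell-time `θ ∈ [Tmin, Tmax]`. -/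
structure JumpCertificate {n p : ℕ} (Tmin Tmax : ℝ) (x : ℝ → Fin n → ℝ)
    (B D : Matrix (Fin n) (Fin n) ℝ) (E : Matrix (Fin n) (Fin p) ℝ)
    (m : Fin n → ℝ) (γ : ℝ) : Prop where
  weight_nonneg : ∀ i, 0 ≤ x 0 i
  jump : EntrywiseNonneg B
  delay : EntrywiseNonneg D
  input : EntrywiseNonneg E
  column : ∀ θ ∈ Icc Tmin Tmax, ∀ j, ∑ i, B i j + ∑ i, D i j + m j ≤ x θ j
  column_input : ∀ j, ∑ i, E i j ≤ γ

theorem skewAbs_mulVec_sum_le {m n : ℕ} {M : Matrix (Fin m) (Fin n) ℝ} (hM : EntrywiseNonneg M)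
    (κ : ℝ) (v : Fin n → ℝ) :
    ∑ i, skewAbs κ ((M *ᵥ v) i) ≤ ∑ j, (∑ i, M i j) * skewAbs κ (v j) := by
  simp only [Finset.sum_mul]
  rw [Finset.sum_comm (f := fun j i => M i j * skewAbs κ (v j))]
  refine Finset.sum_le_sum fun i _ => ?_
  rw [mulVec, dotProduct]
  refine (skewAbs_sum_le κ _ _).trans_eq ?_
  exact Finset.sum_congr rfl fun j _ => skewAbs_mul_of_nonneg (hM i j) _

/-- The column sums of `D` are charged to the current sample `u`: what is stored here pays for the
delayed term when this sample returns as `v`. -/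
theorem JumpCertificate.dissipation {n p : ℕ} {Tmin Tmax : ℝ} {x : ℝ → Fin n → ℝ}
    {B D : Matrix (Fin n) (Fin n) ℝ} {E : Matrix (Fin n) (Fin p) ℝ} {m : Fin n → ℝ} {γ κ : ℝ}
    (H : JumpCertificate Tmin Tmax x B D E m γ) (hκ : 0 ≤ κ) {θ : ℝ} (hθ : θ ∈ Icc Tmin Tmax)
    {u v z : Fin n → ℝ} {δ : Fin p → ℝ}
    (hz : ∀ i, x 0 i * z i = (B *ᵥ u + D *ᵥ v + E *ᵥ δ) i) :
    ∑ i, x 0 i * skewAbs κ (z i) + ∑ j, (∑ i, D i j + m j) * skewAbs κ (u j) ≤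
      ∑ j, x θ j * skewAbs κ (u j) + ∑ j, (∑ i, D i j) * skewAbs κ (v j) +
        γ * ∑ j, skewAbs κ (δ j) := by
  have h1 : ∑ i, x 0 i * skewAbs κ (z i) ≤ ∑ i, skewAbs κ ((B *ᵥ u) i) +
      ∑ i, skewAbs κ ((D *ᵥ v) i) + ∑ i, skewAbs κ ((E *ᵥ δ) i) := by
    rw [← Finset.sum_add_distrib, ← Finset.sum_add_distrib]
    refine Finset.sum_le_sum fun i _ => ?_
    rw [← skewAbs_mul_of_nonneg (H.weight_nonneg i), hz i]
    exact (skewAbs_add_le _ _).trans (add_le_add_left (skewAbs_add_le _ _) _)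
  have h2 : ∑ j, (∑ i, E i j) * skewAbs κ (δ j) ≤ γ * ∑ j, skewAbs κ (δ j) := by
    rw [Finset.mul_sum]
    exact Finset.sum_le_sum fun j _ =>
      mul_le_mul_of_nonneg_right (H.column_input j) (skewAbs_nonneg hκ _)
  have h3 : ∑ j, (∑ i, B i j) * skewAbs κ (u j) + ∑ j, (∑ i, D i j + m j) * skewAbs κ (u j) ≤
      ∑ j, x θ j * skewAbs κ (u j) := by
    rw [← Finset.sum_add_distrib]
    refine Finset.sum_le_sum fun j _ => ?_
    rw [← add_mul]
    exact mul_le_mul_of_nonneg_right (by linarith [H.column θ hθ j]) (skewAbs_nonneg hκ _)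
  linarith [skewAbs_mulVec_sum_le H.jump κ u, skewAbs_mulVec_sum_le H.delay κ v,
    skewAbs_mulVec_sum_le H.input κ δ]

/-! ### Delay terms and the global dissipation inequality. -/

theorem sum_range_delay_le {G : ℤ → ℝ} (hG : ∀ j, 0 ≤ G j) (d k : ℕ) :
    ∑ j ∈ Finset.range k, G (j + 1 - d) ≤
      ∑ j ∈ Finset.range k, G (j + 1) + ∑ j ∈ Finset.range d, G (j + 1 - d) := by
  have h1 : ∑ j ∈ Finset.range k, G (j + 1 - d) ≤ ∑ j ∈ Finset.range (d + k), G (j + 1 - d) :=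
    Finset.sum_le_sum_of_subset_of_nonneg
      (Finset.range_mono (Nat.le_add_left k d)) fun _ _ _ => hG _
  rw [Finset.sum_range_add] at h1
  refine h1.trans_eq ?_
  rw [add_comm]
  congr 1
  refine Finset.sum_congr rfl fun j _ => ?_
  congr 1
  push_cast
  ring

/-- The dropped integral over `[r - h, r]` is the Lyapunov–Krasovskii memory term, of which only the
sign matters. -/
theorem integral_delay_le {F : ℝ → ℝ} {h r : ℝ} (hF : ∀ s, 0 ≤ F s) (hh : 0 ≤ h) (hr : 0 ≤ r)
    (hint : IntervalIntegrable F volume (-h) r) :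
    ∫ s in (0 : ℝ)..r, F (s - h) ≤ (∫ s in (-h)..0, F s) + ∫ s in (0 : ℝ)..r, F s := by
  have hm : ∀ {a b : ℝ}, -h ≤ a → a ≤ b → b ≤ r → IntervalIntegrable F volume a b :=
    fun ha hab hb => hint.mono_set (by
      rw [uIcc_of_le hab, uIcc_of_le (by linarith)]; exact Icc_subset_Icc ha hb)
  rw [intervalIntegral.integral_comp_sub_right F h, zero_sub,
    intervalIntegral.integral_add_adjacent_intervals (hm le_rfl (by linarith) hr)
      (hm (by linarith) hr le_rfl),
    ← intervalIntegral.integral_add_adjacent_intervals (b := r - h)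
      (hm le_rfl (by linarith) (by linarith)) (hm (by linarith) (by linarith) le_rfl)]
  linarith [intervalIntegral.integral_nonneg (μ := volume) (by linarith : r - h ≤ r)
    fun s _ => hF s]

section Trajectory

variable {n p p' : ℕ} {hc : ℝ} {hd : ℕ} {t : ℕ → ℝ}
  {flow : ℝ → (Fin n → ℝ) → (Fin n → ℝ) → (Fin n → ℝ)}
  {jump : ℕ → (Fin n → ℝ) → (Fin n → ℝ) → (Fin n → ℝ)}
  {e : ℝ → Fin n → ℝ} {ψ : ℤ → Fin n → ℝ}

/-- The dissipation inequality of an impulsive system with delays, and the backward estimate of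
the state on each flow interval in terms of the dissipated amounts `S k`. -/
theorem IsTrajectory.dissipation {Tmin Tmax : ℝ} {x xd : ℝ → Fin n → ℝ}
    {B D : ℝ → Matrix (Fin n) (Fin n) ℝ} {E : ℝ → Matrix (Fin n) (Fin p) ℝ}
    {Bj Dj : Matrix (Fin n) (Fin n) ℝ} {Ej : Matrix (Fin n) (Fin p') ℝ} {μ q m : Fin n → ℝ}
    {α γ κ c : ℝ} {δ : ℝ → Fin p → ℝ} {δd : ℕ → Fin p' → ℝ} (ht : RangeDwellTime Tmin Tmax t)
    (h : IsTrajectory hc hd t flow jump e ψ) (hhc : 0 < hc)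
    (H : FlowCertificate Tmax x xd B D E μ q α γ) (Hj : JumpCertificate Tmin Tmax x Bj Dj Ej m γ)
    (hκ : κ ∈ Icc (0 : ℝ) 1) (hc0 : 0 < c) (hcx : ∀ τ ∈ Icc 0 Tmax, ∀ i, c ≤ x τ i)
    (hfl : ∀ k, ∀ s ∈ Ioc (t k) (t (k + 1)), ∀ i, x (s - t k) i * flow s (e s) (e (s - hc)) i =
      (B (s - t k) *ᵥ e s + D (s - t k) *ᵥ e (s - hc) + E (s - t k) *ᵥ δ s) i)
    (hjp : ∀ k a b i, x 0 i * jump k a b i = (Bj *ᵥ a + Dj *ᵥ b + Ej *ᵥ δd k) i)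
    (hδ : ∀ r, 0 ≤ r → ∀ j, IntervalIntegrable (fun s => skewAbs κ (δ s j)) volume 0 r) :
    ∃ S : ℕ → ℝ, (∀ k, 0 ≤ S k) ∧
      (∀ k, ∀ r ∈ Ioc (t k) (t (k + 1)), ∀ i, skewAbs κ (e r i) ≤
        Real.exp (α / c * Tmax) * (skewAbs κ (e (t (k + 1)) i) + S k / c)) ∧
      ∀ k, ∀ r ∈ Ioc (t k) (t (k + 1)),
        ∑ i, x (r - t k) i * skewAbs κ (e r i) + (∫ s in (0 : ℝ)..r, ∑ i, q i * skewAbs κ (e s i)) +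
          ∑ j ∈ Finset.range k, (S j + ∑ i, m i * skewAbs κ (e (t (j + 1)) i)) ≤
        ∑ i, x 0 i * skewAbs κ (e 0 i) + (∫ s in (-hc)..0, ∑ i, μ i * skewAbs κ (e s i)) +
          ∑ j ∈ Finset.range hd, ∑ i, (∑ l, Dj l i) *
            skewAbs κ (sampledState t e ψ ((j : ℤ) + 1 - hd) i) +
          γ * ((∫ s in (0 : ℝ)..r, ∑ i, skewAbs κ (δ s i)) +
            ∑ j ∈ Finset.range k, ∑ i, skewAbs κ (δd (j + 1) i)) := by
  have hflow := h.flow_dissipation ht hhc H hκ hc0 hcx hfl hδ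
  choose S hS hSeq hSlow using fun k => hflow k (right_mem_Ioc.2 (ht.lt_succ k))
  refine ⟨S, hS, hSlow, fun k r hr => ?_⟩
  have hφ := fun z : ℝ => skewAbs_nonneg hκ.1 z
  have hint : ∀ (w : Fin n → ℝ) {a b : ℝ}, -hc ≤ a → -hc ≤ b →
      IntervalIntegrable (fun s => ∑ i, w i * skewAbs κ (e s i)) volume a b := fun w a b ha hb =>
    h.intervalIntegrable_comp ht hhc (g := fun z => ∑ i, w i * skewAbs κ (z i))
      (continuous_finsetSum _ fun i _ =>
        continuous_const.mul ((continuous_skewAbs κ).comp (continuous_apply i))) ha hb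
  have hdelay : ∀ {r : ℝ}, 0 ≤ r →
      IntervalIntegrable (fun s => ∑ i, μ i * skewAbs κ (e (s - hc) i)) volume 0 r :=
    fun {r} hr => by
      simpa using (hint μ (a := 0 - hc) (b := r - hc) (by linarith) (by linarith)).comp_sub_right hc
  have hδs : ∀ {r : ℝ}, 0 ≤ r →
      IntervalIntegrable (fun s => ∑ i, skewAbs κ (δ s i)) volume 0 r := fun {r} hr => by
    refine (IntervalIntegrable.sum Finset.univ fun j _ => hδ r hr j).congr fun s _ => ?_
    simp [Finset.sum_apply]
  have hsupp : ∀ {r : ℝ}, 0 ≤ r → IntervalIntegrable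
      (fun s => FlowCertificate.supply μ q γ κ (e s) (e (s - hc)) (δ s)) volume 0 r :=
    fun {r} hr => ((hdelay hr).add ((hδs hr).const_mul γ)).sub
      (hint (fun j => μ j + q j) (by linarith) (by linarith))
  set G : ℤ → ℝ := fun j => ∑ i, (∑ l, Dj l i) * skewAbs κ (sampledState t e ψ j i) with hG
  have hG0 : ∀ j, 0 ≤ G j := fun j => Finset.sum_nonneg fun i _ =>
    mul_nonneg (Finset.sum_nonneg fun l _ => Hj.delay l i) (hφ _)
  have hGs : ∀ j : ℕ, G ((j : ℤ) + 1) = ∑ i, (∑ l, Dj l i) * skewAbs κ (e (t (j + 1)) i) :=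
    fun j => by
      have : sampledState t e ψ ((j : ℤ) + 1) = e (t (j + 1)) := by
        rw [sampledState, if_pos (by positivity)]
        congr 2
      simp only [hG, this]
  have hsplit : ∀ {a b : ℝ}, 0 ≤ a → a ≤ b →
      (∫ s in (0 : ℝ)..a, FlowCertificate.supply μ q γ κ (e s) (e (s - hc)) (δ s)) +
        (∫ s in a..b, FlowCertificate.supply μ q γ κ (e s) (e (s - hc)) (δ s)) =
      ∫ s in (0 : ℝ)..b, FlowCertificate.supply μ q γ κ (e s) (e (s - hc)) (δ s) :=
    fun {a b} ha hab => intervalIntegral.integral_add_adjacent_intervals (hsupp ha)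
      ((hsupp (ha.trans hab)).mono_set (by
        rw [uIcc_of_le hab, uIcc_of_le (ha.trans hab)]; exact Icc_subset_Icc_left ha))
  -- Energy just after the `k`-th jump, by induction over complete flow intervals. The stored sum of
  -- `G (j + 1)` on the left later absorbs the delayed sum of `G (j + 1 - hd)`, up to initial
  -- samples.
  have hpost : ∀ k : ℕ, ∑ i, x 0 i * skewAbs κ (postJumpState hd t jump e ψ k i) +
      ∑ j ∈ Finset.range k, (S j + ∑ i, m i * skewAbs κ (e (t (j + 1)) i)) +
      ∑ j ∈ Finset.range k, G ((j : ℤ) + 1) ≤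
      ∑ i, x 0 i * skewAbs κ (e 0 i) +
      (∫ s in (0 : ℝ)..(t k), FlowCertificate.supply μ q γ κ (e s) (e (s - hc)) (δ s)) +
      ∑ j ∈ Finset.range k, G ((j : ℤ) + 1 - hd) +
      γ * ∑ j ∈ Finset.range k, ∑ i, skewAbs κ (δd (j + 1) i) := fun k => by
    induction k with
    | zero => simp [postJumpState, ht.zero]
    | succ k ih =>
      have hz : ∀ i, x 0 i * postJumpState hd t jump e ψ (k + 1) i =
          (Bj *ᵥ e (t (k + 1)) + Dj *ᵥ sampledState t e ψ ((k : ℤ) + 1 - hd) +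
            Ej *ᵥ δd (k + 1)) i := fun i => by
        rw [postJumpState, if_neg (Nat.succ_ne_zero k), hjp]
        push_cast
        rfl
      have hstep := Hj.dissipation hκ.1 (ht.dwell_mem k) hz
      simp only [add_mul, Finset.sum_add_distrib] at hstep
      simp only [Finset.sum_range_succ, mul_add, hGs k]
      rw [← hsplit (ht.nonneg k) (ht.lt_succ k).le]
      have hGd : G ((k : ℤ) + 1 - hd) = ∑ i, (∑ l, Dj l i) *
        skewAbs κ (sampledState t e ψ ((k : ℤ) + 1 - hd) i) := rfl
      rw [hGd]
      linarith [hSeq k]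
  -- The last, possibly incomplete, flow interval: its slack `S'` is discarded.
  obtain ⟨S', hS', hS'eq, -⟩ := hflow k hr
  have hr0 : 0 ≤ r := (ht.nonneg k).trans hr.1.le
  have hsup : (∫ s in (0 : ℝ)..r, FlowCertificate.supply μ q γ κ (e s) (e (s - hc)) (δ s)) ≤
      (∫ s in (-hc)..0, ∑ i, μ i * skewAbs κ (e s i)) +
        γ * (∫ s in (0 : ℝ)..r, ∑ i, skewAbs κ (δ s i)) -
        ∫ s in (0 : ℝ)..r, ∑ i, q i * skewAbs κ (e s i) := by
    have hi1 := hint μ (a := 0) (b := r) (by linarith) (by linarith)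
    have hi2 := hint q (a := 0) (b := r) (by linarith) (by linarith)
    have h1 : (∫ s in (0 : ℝ)..r, FlowCertificate.supply μ q γ κ (e s) (e (s - hc)) (δ s)) =
        (∫ s in (0 : ℝ)..r, ∑ i, μ i * skewAbs κ (e (s - hc) i)) +
        γ * (∫ s in (0 : ℝ)..r, ∑ i, skewAbs κ (δ s i)) -
        ((∫ s in (0 : ℝ)..r, ∑ i, μ i * skewAbs κ (e s i)) +
          ∫ s in (0 : ℝ)..r, ∑ i, q i * skewAbs κ (e s i)) := by
      rw [← intervalIntegral.integral_const_mul, ← intervalIntegral.integral_add hi1 hi2,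
        ← intervalIntegral.integral_add (hdelay hr0) ((hδs hr0).const_mul γ),
        ← intervalIntegral.integral_sub ((hdelay hr0).add ((hδs hr0).const_mul γ)) (hi1.add hi2)]
      simp only [FlowCertificate.supply, add_mul, Finset.sum_add_distrib]
    have h2 := integral_delay_le (F := fun s => ∑ i, μ i * skewAbs κ (e s i))
      (fun s => Finset.sum_nonneg fun i _ => mul_nonneg (H.delay_weight_nonneg i) (hφ _))
      hhc.le hr0 (hint μ le_rfl (by linarith))
    linarith
  have hGsum := sum_range_delay_le hG0 hd k
  have hp := hpost k
  have hs := hsplit (ht.nonneg k) hr.1.le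
  rw [mul_add]
  linarith

end Trajectory

/-! ### Differences of trajectories, initial energy and diagonal weights. -/

/-- The identities are required only along the two given trajectories: an observer sees the measured
output as a fixed signal, which is tied to the state only along `x`. -/
theorem IsTrajectory.sub {n : ℕ} {hc : ℝ} {hd : ℕ} {t : ℕ → ℝ}
    {flow flow₁ flow₂ : ℝ → (Fin n → ℝ) → (Fin n → ℝ) → (Fin n → ℝ)}
    {jump jump₁ jump₂ : ℕ → (Fin n → ℝ) → (Fin n → ℝ) → (Fin n → ℝ)}
    {x₁ x₂ : ℝ → Fin n → ℝ} {ψ₁ ψ₂ : ℤ → Fin n → ℝ}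
    (h₁ : IsTrajectory hc hd t flow₁ jump₁ x₁ ψ₁) (h₂ : IsTrajectory hc hd t flow₂ jump₂ x₂ ψ₂)
    (hflow : ∀ s, flow s (x₁ s - x₂ s) (x₁ (s - hc) - x₂ (s - hc)) =
      flow₁ s (x₁ s) (x₁ (s - hc)) - flow₂ s (x₂ s) (x₂ (s - hc)))
    (hjump : ∀ k, jump k (x₁ (t k) - x₂ (t k))
        (sampledState t x₁ ψ₁ ((k : ℤ) - hd) - sampledState t x₂ ψ₂ ((k : ℤ) - hd)) =
      jump₁ k (x₁ (t k)) (sampledState t x₁ ψ₁ ((k : ℤ) - hd)) -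
        jump₂ k (x₂ (t k)) (sampledState t x₂ ψ₂ ((k : ℤ) - hd))) :
    IsTrajectory hc hd t flow jump (x₁ - x₂) (ψ₁ - ψ₂) := by
  have hsamp : ∀ j, sampledState t (x₁ - x₂) (ψ₁ - ψ₂) j =
      sampledState t x₁ ψ₁ j - sampledState t x₂ ψ₂ j := fun j => by
    unfold sampledState; split_ifs <;> rfl
  have hpost : ∀ k, postJumpState hd t jump (x₁ - x₂) (ψ₁ - ψ₂) k =
      postJumpState hd t jump₁ x₁ ψ₁ k - postJumpState hd t jump₂ x₂ ψ₂ k := fun k => by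
    unfold postJumpState
    split_ifs
    · rfl
    · rw [hsamp]; exact hjump k
  have hf : ∀ s, flow s ((x₁ - x₂) s) ((x₁ - x₂) (s - hc)) =
      flow₁ s (x₁ s) (x₁ (s - hc)) - flow₂ s (x₂ s) (x₂ (s - hc)) := hflow
  refine ⟨h₁.initial_continuous.sub h₂.initial_continuous, fun k => ?_, fun k r hr => ?_⟩
  · simp only [hf]
    exact (h₁.integrable k).sub (h₂.integrable k)
  · have hi : ∀ {f : ℝ → Fin n → ℝ}, IntegrableOn f (Ioc (t k) (t (k + 1))) →
        IntervalIntegrable f volume (t k) r := fun hf => by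
      rw [intervalIntegrable_iff_integrableOn_Ioc_of_le hr.1.le]
      exact hf.mono_set (Ioc_subset_Ioc_right hr.2)
    simp only [hf]
    rw [hpost, intervalIntegral.integral_sub (hi (h₁.integrable k)) (hi (h₂.integrable k)),
      Pi.sub_apply, h₁.integral_eq k r hr, h₂.integral_eq k r hr]
    abel

theorem initial_energy_le {n : ℕ} {hc : ℝ} {hd : ℕ} {t : ℕ → ℝ} {e : ℝ → Fin n → ℝ}
    {ψ : ℤ → Fin n → ℝ} {x₀ μ g : Fin n → ℝ} {κ R : ℝ} (ht : t 0 = 0) (hhc : 0 < hc)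
    (hx₀ : ∀ i, 0 ≤ x₀ i) (hμ : ∀ i, 0 ≤ μ i) (hg : ∀ i, 0 ≤ g i)
    (hint : IntervalIntegrable (fun s => ∑ i, μ i * skewAbs κ (e s i)) volume (-hc) 0)
    (he : ∀ s ∈ Icc (-hc) 0, ∀ i, skewAbs κ (e s i) ≤ R)
    (hψ : ∀ j ∈ Ico (1 - (hd : ℤ)) 0, ∀ i, skewAbs κ (ψ j i) ≤ R) :
    ∑ i, x₀ i * skewAbs κ (e 0 i) + (∫ s in (-hc)..0, ∑ i, μ i * skewAbs κ (e s i)) +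
      ∑ j ∈ Finset.range hd, ∑ i, g i * skewAbs κ (sampledState t e ψ ((j : ℤ) + 1 - hd) i) ≤
    (∑ i, x₀ i + hc * ∑ i, μ i + hd * ∑ i, g i) * R := by
  have h0 : (0 : ℝ) ∈ Icc (-hc) 0 := ⟨by linarith, le_rfl⟩
  have hw : ∀ {w : Fin n → ℝ} {z : Fin n → ℝ}, (∀ i, 0 ≤ w i) → (∀ i, skewAbs κ (z i) ≤ R) →
      ∑ i, w i * skewAbs κ (z i) ≤ (∑ i, w i) * R := fun hw hz => by
    rw [Finset.sum_mul]
    exact Finset.sum_le_sum fun i _ => mul_le_mul_of_nonneg_left (hz i) (hw i)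
  have h1 := hw hx₀ (he 0 h0)
  have h2 : (∫ s in (-hc)..0, ∑ i, μ i * skewAbs κ (e s i)) ≤ hc * ((∑ i, μ i) * R) := by
    have := intervalIntegral.integral_mono_on (by linarith) hint
      (intervalIntegrable_const (c := (∑ i, μ i) * R)) fun s hs => hw hμ (he s hs)
    simpa [mul_left_comm] using this
  have h3 : ∑ j ∈ Finset.range hd,
      ∑ i, g i * skewAbs κ (sampledState t e ψ ((j : ℤ) + 1 - hd) i) ≤
      ∑ j ∈ Finset.range hd, (∑ i, g i) * R := by
    refine Finset.sum_le_sum fun j hj => hw hg fun i => ?_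
    have hj' := Finset.mem_range.1 hj
    unfold sampledState
    split_ifs with hs
    -- The only nonnegative index in this range is `0`, whose sample `e 0` belongs to the continuous
    -- initial data.
    · have : ((j : ℤ) + 1 - hd).toNat = 0 := by omega
      rw [this, ht]
      exact he 0 h0 i
    · exact hψ _ ⟨by omega, by omega⟩ i
  rw [Finset.sum_const, Finset.card_range, nsmul_eq_mul] at h3
  linarith

theorem Matrix.IsDiag.mul_mulVec_apply {m n : ℕ} {X : Matrix (Fin m) (Fin m) ℝ} (hX : X.IsDiag)
    (M : Matrix (Fin m) (Fin n) ℝ) (v : Fin n → ℝ) (i : Fin m) :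
    ((X * M) *ᵥ v) i = X i i * (M *ᵥ v) i := by
  rw [← mulVec_mulVec]
  conv_lhs => rw [← hX.diagonal_diag, mulVec_diagonal]
  rfl

theorem Matrix.IsDiag.mul_apply {m n : ℕ} {X : Matrix (Fin m) (Fin m) ℝ} (hX : X.IsDiag)
    (M : Matrix (Fin m) (Fin n) ℝ) (i : Fin m) (j : Fin n) : (X * M) i j = X i i * M i j := by
  conv_lhs => rw [← hX.diagonal_diag, diagonal_mul]
  rfl

theorem Matrix.IsDiag.apply_ne_zero {m : ℕ} {X : Matrix (Fin m) (Fin m) ℝ} (hX : X.IsDiag)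
    (hu : IsUnit X) (i : Fin m) : X i i ≠ 0 := by
  rw [← hX.diagonal_diag, isUnit_diagonal, Pi.isUnit_iff] at hu
  exact (hu i).ne_zero

/-- A diagonal matrix path that stays invertible and starts positive definite stays positive. -/
theorem diag_pos_of_isUnit {n : ℕ} {T : ℝ} {X : ℝ → Matrix (Fin n) (Fin n) ℝ}
    (hdiag : ∀ τ ∈ Icc 0 T, (X τ).IsDiag) (hcont : ∀ i, ContinuousOn (fun τ => X τ i i) (Icc 0 T))
    (h0 : (X 0).PosDef) (hu : ∀ τ ∈ Icc 0 T, IsUnit (X τ)) :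
    ∀ τ ∈ Icc 0 T, ∀ i, 0 < X τ i i := by
  intro τ hτ i
  by_contra! hneg
  have hsub : Icc 0 τ ⊆ Icc 0 T := Icc_subset_Icc_right hτ.2
  obtain ⟨s, hs, hs0⟩ := intermediate_value_Icc' hτ.1 ((hcont i).mono hsub)
    ⟨hneg, h0.diag_pos.le⟩
  exact (hdiag s (hsub hs)).apply_ne_zero (hu s (hsub hs)) i hs0

theorem FlowCertificate.exists_weight_lower_bound {n p : ℕ} {T : ℝ} {x xd : ℝ → Fin n → ℝ}
    {B D : ℝ → Matrix (Fin n) (Fin n) ℝ} {E : ℝ → Matrix (Fin n) (Fin p) ℝ} {μ q : Fin n → ℝ}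
    {α γ : ℝ} (H : FlowCertificate T x xd B D E μ q α γ) (hT : 0 ≤ T) :
    ∃ c, 0 < c ∧ ∀ τ ∈ Icc 0 T, ∀ i, c ≤ x τ i := by
  have h1 : ∀ i, ∃ c, 0 < c ∧ ∀ τ ∈ Icc 0 T, c ≤ x τ i := fun i => by
    obtain ⟨τ, hτ, hmin⟩ := isCompact_Icc.exists_isMinOn (nonempty_Icc.2 hT)
      fun s hs => (H.hasDeriv s hs i).continuousWithinAt
    exact ⟨x τ i, H.weight_pos τ hτ i, fun s hs => hmin hs⟩
  choose c hc hcx using h1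
  have h2 : ∀ᶠ a in 𝓝[>] (0 : ℝ), ∀ i, a ≤ c i := eventually_all.2 fun i =>
    mem_nhdsWithin_of_mem_nhds (Iic_mem_nhds (hc i))
  obtain ⟨a, ha, ha0⟩ := (h2.and self_mem_nhdsWithin).exists
  exact ⟨a, ha0, fun τ hτ i => (ha i).trans (hcx i τ hτ)⟩

/-! ### Positivity, stability and gain of the error dynamics. -/

/-- Flow and jump certificates, weighted by a diagonal matrix path `X`, of the error dynamics with
gains `Lt`, `Ld`. -/
structure ErrorCertificate {n pc pd rc rd : ℕ} (P : ImpulsiveDelaySystem n pc pd rc rd)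
    (Tmin Tmax : ℝ) (X : ℝ → Matrix (Fin n) (Fin n) ℝ) (xd : ℝ → Fin n → ℝ)
    (Lt : ℝ → Matrix (Fin n) (Fin rc) ℝ) (Ld : Matrix (Fin n) (Fin rd) ℝ)
    (μ q m : Fin n → ℝ) (α γ : ℝ) : Prop where
  isDiag : ∀ τ ∈ Icc 0 Tmax, (X τ).IsDiag
  flow : FlowCertificate Tmax (fun τ i => X τ i i) xd (fun τ => X τ * (P.A - Lt τ * P.Cyc))
    (fun τ => X τ * (P.Gc - Lt τ * P.Hyc)) (fun τ => X τ * (P.Ec - Lt τ * P.Fyc)) μ q α γ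
  jump : JumpCertificate Tmin Tmax (fun τ i => X τ i i) (X 0 * (P.J - Ld * P.Cyd))
    (X 0 * (P.Gd - Ld * P.Hyd)) (X 0 * (P.Ed - Ld * P.Fyd)) m γ

namespace ErrorCertificate

variable {n pc pd rc rd : ℕ} {P : ImpulsiveDelaySystem n pc pd rc rd}
  {Tmin Tmax : ℝ} {X : ℝ → Matrix (Fin n) (Fin n) ℝ} {xd : ℝ → Fin n → ℝ}
  {Lt : ℝ → Matrix (Fin n) (Fin rc) ℝ} {Ld : Matrix (Fin n) (Fin rd) ℝ}
  {μ q m : Fin n → ℝ} {α γ : ℝ}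

/-- The gain from the size of the initial data to the initial energy. -/
noncomputable def initialGain (P : ImpulsiveDelaySystem n pc pd rc rd)
    (X : ℝ → Matrix (Fin n) (Fin n) ℝ) (Ld : Matrix (Fin n) (Fin rd) ℝ) (μ : Fin n → ℝ) : ℝ :=
  ∑ i, X 0 i i + P.hc * ∑ i, μ i + P.hd * ∑ i, ∑ l, (X 0 * (P.Gd - Ld * P.Hyd)) l i

theorem initialGain_nonneg (H : ErrorCertificate P Tmin Tmax X xd Lt Ld μ q m α γ) :
    0 ≤ initialGain P X Ld μ :=
  add_nonneg (add_nonneg (Finset.sum_nonneg fun i _ => H.jump.weight_nonneg i)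
    (mul_nonneg P.hc_pos.le (Finset.sum_nonneg fun i _ => H.flow.delay_weight_nonneg i)))
    (mul_nonneg (Nat.cast_nonneg _) (Finset.sum_nonneg fun i _ =>
      Finset.sum_nonneg fun l _ => H.jump.delay l i))

/-- `I` is the initial energy, of which only a linear bound is used. That bound is stated through
`skewAbs κ`, so for `κ = 0` nonnegative data of any size give `I ≤ 0`. -/
theorem dissipation (H : ErrorCertificate P Tmin Tmax X xd Lt Ld μ q m α γ)
    {t : ℕ → ℝ} (ht : RangeDwellTime Tmin Tmax t) {Lc : ℝ → Matrix (Fin n) (Fin rc) ℝ}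
    (hLc : IsTimerGain t Lt Lc) {δc : ℝ → Fin pc → ℝ} {δd : ℕ → Fin pd → ℝ}
    {e : ℝ → Fin n → ℝ} {ψ : ℤ → Fin n → ℝ} (he : P.IsErrorTrajectory t Lc Ld δc δd e ψ)
    {κ c : ℝ} (hκ : κ ∈ Icc (0 : ℝ) 1) (hc0 : 0 < c)
    (hcX : ∀ τ ∈ Icc 0 Tmax, ∀ i, c ≤ X τ i i)
    (hδ : ∀ r, 0 ≤ r → ∀ j, IntervalIntegrable (fun s => skewAbs κ (δc s j)) volume 0 r) :
    ∃ (S : ℕ → ℝ) (I : ℝ), (∀ k, 0 ≤ S k) ∧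
      (∀ R, (∀ s ∈ Icc (-P.hc) 0, ∀ i, skewAbs κ (e s i) ≤ R) →
        (∀ j ∈ Ico (1 - (P.hd : ℤ)) 0, ∀ i, skewAbs κ (ψ j i) ≤ R) →
        I ≤ initialGain P X Ld μ * R) ∧
      (∀ k, ∀ r ∈ Ioc (t k) (t (k + 1)), ∀ i, skewAbs κ (e r i) ≤
        Real.exp (α / c * Tmax) * (skewAbs κ (e (t (k + 1)) i) + S k / c)) ∧
      ∀ k, ∀ r ∈ Ioc (t k) (t (k + 1)),
        c * ∑ i, skewAbs κ (e r i) + (∫ s in (0 : ℝ)..r, ∑ i, q i * skewAbs κ (e s i)) +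
          ∑ j ∈ Finset.range k, (S j + ∑ i, m i * skewAbs κ (e (t (j + 1)) i)) ≤
        I + γ * ((∫ s in (0 : ℝ)..r, ∑ i, skewAbs κ (δc s i)) +
            ∑ j ∈ Finset.range k, ∑ i, skewAbs κ (δd (j + 1) i)) := by
  have hτ : ∀ k, ∀ s ∈ Ioc (t k) (t (k + 1)), s - t k ∈ Icc 0 Tmax := fun k s hs =>
    ⟨sub_nonneg.2 hs.1.le, (sub_le_sub_right hs.2 _).trans (ht.dwell_mem k).2⟩
  have hT : (0 : ℝ) ≤ Tmax := (sub_nonneg.2 (ht.lt_succ 0).le).trans (ht.dwell_mem 0).2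
  obtain ⟨S, hS, hlow, hmain⟩ := IsTrajectory.dissipation (δ := δc) (δd := δd) ht he P.hc_pos
    H.flow H.jump hκ hc0 hcX
    (fun k s hs i => by
      have hD := H.isDiag _ (hτ k s hs)
      simp only [Pi.add_apply, hD.mul_mulVec_apply, hLc k s hs]
      ring)
    (fun k a b i => by
      have hD := H.isDiag 0 ⟨le_rfl, hT⟩
      simp only [Pi.add_apply, hD.mul_mulVec_apply]
      ring) hδ
  refine ⟨S, _, hS, fun R hR hψ => initial_energy_le ht.zero P.hc_pos H.jump.weight_nonneg
    H.flow.delay_weight_nonneg (fun i => Finset.sum_nonneg fun l _ => H.jump.delay l i) ?_ hR hψ,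
    hlow, fun k r hr => le_trans ?_ (hmain k r hr)⟩
  · exact he.intervalIntegrable_comp ht P.hc_pos (g := fun z => ∑ i, μ i * skewAbs κ (z i))
      (continuous_finsetSum _ fun i _ =>
        continuous_const.mul ((continuous_skewAbs κ).comp (continuous_apply i)))
      le_rfl (by linarith [P.hc_pos])
  · gcongr
    rw [Finset.mul_sum]
    exact Finset.sum_le_sum fun i _ =>
      mul_le_mul_of_nonneg_right (hcX _ (hτ k r hr) i) (skewAbs_nonneg hκ.1 _)

theorem nonneg (H : ErrorCertificate P Tmin Tmax X xd Lt Ld μ q m α γ) (hm : ∀ i, 0 ≤ m i)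
    {t : ℕ → ℝ} (ht : RangeDwellTime Tmin Tmax t) {Lc : ℝ → Matrix (Fin n) (Fin rc) ℝ}
    (hLc : IsTimerGain t Lt Lc) {δc : ℝ → Fin pc → ℝ} {δd : ℕ → Fin pd → ℝ}
    {e : ℝ → Fin n → ℝ} {ψ : ℤ → Fin n → ℝ} (he : P.IsErrorTrajectory t Lc Ld δc δd e ψ)
    (hδc : ∀ s, 0 ≤ s → 0 ≤ δc s) (hδd : ∀ k, 0 ≤ δd k)
    (hinit : ∀ s ∈ Icc (-P.hc) 0, 0 ≤ e s) (hψ : ∀ j ∈ Ico (1 - (P.hd : ℤ)) 0, 0 ≤ ψ j)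
    {s : ℝ} (hs : 0 ≤ s) : 0 ≤ e s := by
  rcases hs.eq_or_lt with rfl | hs
  · exact hinit 0 ⟨by linarith [P.hc_pos], le_rfl⟩
  have hT : (0 : ℝ) ≤ Tmax := (sub_nonneg.2 (ht.lt_succ 0).le).trans (ht.dwell_mem 0).2
  obtain ⟨c, hc0, hcX⟩ := H.flow.exists_weight_lower_bound hT
  have hzero : ∀ s, 0 ≤ s → ∀ j, skewAbs 0 (δc s j) = 0 := fun s hs j =>
    skewAbs_zero_of_nonneg (hδc s hs j)
  -- The negative part of `δc` vanishes on `[0, r]`, so no integrability of the input itself is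
  -- needed.
  obtain ⟨S, I, hS, hI, -, hmain⟩ := H.dissipation ht hLc he (κ := 0) (by simp) hc0 hcX
    fun r hr j => (intervalIntegrable_const (c := (0 : ℝ))).congr fun s hs => by
      rw [uIoc_of_le hr] at hs
      exact (hzero s hs.1.le j).symm
  have hI0 := hI 0 (fun s hs i => (skewAbs_zero_of_nonneg (hinit s hs i)).le)
    fun j hj i => (skewAbs_zero_of_nonneg (hψ j hj i)).le
  rw [mul_zero] at hI0
  obtain ⟨k, hk⟩ := ht.exists_mem_Ioc hs
  have h := hmain k s hk
  have h1 : (∫ r in (0 : ℝ)..s, ∑ i, skewAbs 0 (δc r i)) = 0 := by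
    rw [intervalIntegral.integral_congr (g := fun _ => (0 : ℝ)) fun r hr => ?_]
    · simp
    · rw [uIcc_of_le hs.le] at hr
      exact Finset.sum_eq_zero fun i _ => hzero r hr.1 i
  have h2 : ∑ j ∈ Finset.range k, ∑ i, skewAbs 0 (δd (j + 1) i) = 0 :=
    Finset.sum_eq_zero fun j _ => Finset.sum_eq_zero fun i _ =>
      skewAbs_zero_of_nonneg (hδd (j + 1) i)
  have h3 : 0 ≤ ∫ r in (0 : ℝ)..s, ∑ i, q i * skewAbs 0 (e r i) :=
    intervalIntegral.integral_nonneg hs.le fun r _ => Finset.sum_nonneg fun i _ =>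
      mul_nonneg (H.flow.output_weight_nonneg i) (skewAbs_nonneg le_rfl _)
  have h4 : 0 ≤ ∑ j ∈ Finset.range k, (S j + ∑ i, m i * skewAbs 0 (e (t (j + 1)) i)) :=
    Finset.sum_nonneg fun j _ => add_nonneg (hS j) (Finset.sum_nonneg fun i _ =>
      mul_nonneg (hm i) (skewAbs_nonneg le_rfl _))
  rw [h1, h2, add_zero, mul_zero] at h
  have h5 : ∑ i, skewAbs 0 (e s i) ≤ 0 := by
    by_contra! hpos
    linarith [mul_pos hc0 hpos]
  intro i
  exact nonneg_of_skewAbs_zero_le ((Finset.single_le_sum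
    (fun i _ => skewAbs_nonneg le_rfl (e s i)) (Finset.mem_univ i)).trans h5)

/-- An admissible impulse sequence forces `0 < Tmax`, so the certificate is needed only in that
case. -/
theorem isIntervalObserver (H : 0 < Tmax → ErrorCertificate P Tmin Tmax X xd Lt Ld μ q m α γ)
    (hm : ∀ i, 0 ≤ m i) : P.IsIntervalObserver Tmin Tmax Lt Ld := by
  intro t ht Lc hLc wc wcm wcp hwc wd wdm wdp hwd x xm xp ψ ψm ψp hx hxm hxp hlow hupp
  have hT : 0 < Tmax := (sub_pos.2 (ht.lt_succ 0)).trans_le (ht.dwell_mem 0).2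
  have hp : P.IsErrorTrajectory t Lc Ld (wcp - wc) (wdp - wd) (xp - x) (ψp - ψ) := by
    refine IsTrajectory.sub hxp hx (fun s => ?_) fun k => ?_
    · simp only [ImpulsiveDelaySystem.outputC, Pi.sub_apply, mulVec_sub, mulVec_add, sub_mulVec,
        mulVec_mulVec]
      abel
    · simp only [ImpulsiveDelaySystem.outputD, Pi.sub_apply, mulVec_sub, mulVec_add, sub_mulVec,
        mulVec_mulVec]
      abel
  have hn : P.IsErrorTrajectory t Lc Ld (wc - wcm) (wd - wdm) (x - xm) (ψ - ψm) := by
    refine IsTrajectory.sub hx hxm (fun s => ?_) fun k => ?_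
    · simp only [ImpulsiveDelaySystem.outputC, Pi.sub_apply, mulVec_sub, mulVec_add, sub_mulVec,
        mulVec_mulVec]
      abel
    · simp only [ImpulsiveDelaySystem.outputD, Pi.sub_apply, mulVec_sub, mulVec_add, sub_mulVec,
        mulVec_mulVec]
      abel
  refine ⟨hp, hn, fun s hs => ⟨sub_nonneg.1 ?_, sub_nonneg.1 ?_⟩⟩
  · exact (H hT).nonneg hm ht hLc hn (fun s hs => sub_nonneg.2 (hwc s hs).1)
      (fun k => sub_nonneg.2 (hwd k).1) (fun s hs => sub_nonneg.2 (hlow.1 s hs))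
      (fun j hj => sub_nonneg.2 (hlow.2 j hj)) hs
  · exact (H hT).nonneg hm ht hLc hp (fun s hs => sub_nonneg.2 (hwc s hs).2)
      (fun k => sub_nonneg.2 (hwd k).2) (fun s hs => sub_nonneg.2 (hupp.1 s hs))
      (fun j hj => sub_nonneg.2 (hupp.2 j hj)) hs

/-- The dissipation inequality for the unweighted `1`-norm. -/
theorem abs_dissipation (H : ErrorCertificate P Tmin Tmax X xd Lt Ld μ q m α γ)
    {t : ℕ → ℝ} (ht : RangeDwellTime Tmin Tmax t) {Lc : ℝ → Matrix (Fin n) (Fin rc) ℝ}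
    (hLc : IsTimerGain t Lt Lc) {δc : ℝ → Fin pc → ℝ} {δd : ℕ → Fin pd → ℝ}
    {e : ℝ → Fin n → ℝ} {ψ : ℤ → Fin n → ℝ} (he : P.IsErrorTrajectory t Lc Ld δc δd e ψ)
    {c : ℝ} (hc0 : 0 < c) (hcX : ∀ τ ∈ Icc 0 Tmax, ∀ i, c ≤ X τ i i)
    (hδ : ∀ r, 0 ≤ r → ∀ j, IntervalIntegrable (fun s => |δc s j|) volume 0 r) :
    ∃ (S : ℕ → ℝ) (I : ℝ), (∀ k, 0 ≤ S k) ∧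
      (∀ R, InitialDataBound P.hc P.hd e ψ R → I ≤ initialGain P X Ld μ * R) ∧
      (∀ k, ∀ r ∈ Ioc (t k) (t (k + 1)), ∀ i, |e r i| ≤
        Real.exp (α / c * Tmax) * (|e (t (k + 1)) i| + S k / c)) ∧
      ∀ k, ∀ r ∈ Ioc (t k) (t (k + 1)),
        c * vecL1 (e r) + (∫ s in (0 : ℝ)..r, ∑ i, q i * |e s i|) +
          ∑ j ∈ Finset.range k, (S j + ∑ i, m i * |e (t (j + 1)) i|) ≤
        I + γ * ((∫ s in (0 : ℝ)..r, vecL1 (δc s)) +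
            ∑ j ∈ Finset.range k, vecL1 (δd (j + 1))) := by
  obtain ⟨S, I, hS, hI, hlow, hmain⟩ := H.dissipation ht hLc he (κ := 1) (by simp) hc0 hcX
    (by simpa only [skewAbs_one] using hδ)
  simp only [skewAbs_one] at hI hlow hmain
  exact ⟨S, I, hS, fun R hR => hI R (fun s hs i => (norm_le_pi_norm (e s) i).trans (hR.1 s hs))
    fun j hj i => (norm_le_pi_norm (ψ j) i).trans (hR.2 j hj), hlow, hmain⟩

/-- Stability is the energy bound. For attractivity, strict positivity of `m` makes the sampled
errors summable together with the slacks `S k`, and the backward estimate extends the decay to the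
times between impulses. -/
theorem stable (H : 0 < Tmax → ErrorCertificate P Tmin Tmax X xd Lt Ld μ q m α γ)
    (hm : ∀ i, 0 < m i) : P.ErrorAsymptoticallyStable Tmin Tmax Lt Ld := by
  have hδ : ∀ r : ℝ, 0 ≤ r → ∀ j : Fin pc,
      IntervalIntegrable (fun s => |(0 : ℝ → Fin pc → ℝ) s j|) volume 0 r := fun r _ j => by simp
  have hTpos : ∀ {t}, RangeDwellTime Tmin Tmax t → 0 < Tmax := fun ht =>
    (sub_pos.2 (ht.lt_succ 0)).trans_le (ht.dwell_mem 0).2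
  refine ⟨fun ε hε => ?_, fun t ht Lc hLc e ψ he => ?_⟩
  · by_cases hT : 0 < Tmax
    swap
    · exact ⟨1, one_pos, fun t ht => absurd (hTpos ht) hT⟩
    obtain ⟨c, hc0, hcX⟩ := (H hT).flow.exists_weight_lower_bound hT.le
    set K := initialGain P X Ld μ / c with hK
    have hK0 : 0 ≤ K := div_nonneg (H hT).initialGain_nonneg hc0.le
    -- The energy gives the factor `K`; the added `1` covers `s = 0` and keeps the denominator
    -- positive.
    refine ⟨ε / (2 * (K + 1)), by positivity, fun t ht Lc hLc e ψ he hb s hs => ?_⟩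
    set d := ε / (2 * (K + 1)) with hd
    have hd0 : 0 < d := by positivity
    have hdε : (K + 1) * d < ε := by
      have : (K + 1) * d = ε / 2 := by rw [hd]; field_simp
      linarith
    suffices hsuff : ‖e s‖ ≤ (K + 1) * d from hsuff.trans_lt hdε
    rcases hs.eq_or_lt with rfl | hs
    · refine (hb.1 0 ⟨by linarith [P.hc_pos], le_rfl⟩).trans ?_
      nlinarith
    obtain ⟨S, I, hS, hI, -, hmain⟩ := (H hT).abs_dissipation ht hLc he hc0 hcX hδ
    obtain ⟨k, hk⟩ := ht.exists_mem_Ioc hs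
    have h := hmain k s hk
    have h3 : 0 ≤ ∫ r in (0 : ℝ)..s, ∑ i, q i * |e r i| :=
      intervalIntegral.integral_nonneg hs.le fun r _ => Finset.sum_nonneg fun i _ =>
        mul_nonneg ((H hT).flow.output_weight_nonneg i) (abs_nonneg _)
    have h4 : 0 ≤ ∑ j ∈ Finset.range k, (S j + ∑ i, m i * |e (t (j + 1)) i|) :=
      Finset.sum_nonneg fun j _ => add_nonneg (hS j) (Finset.sum_nonneg fun i _ =>
        mul_nonneg (hm i).le (abs_nonneg _))
    simp only [vecL1, Pi.zero_apply, abs_zero, Finset.sum_const_zero,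
      intervalIntegral.integral_zero, add_zero, mul_zero] at h
    have h5 : ∑ i, |e s i| ≤ K * d := by
      rw [hK, div_mul_eq_mul_div, le_div_iff₀ hc0]
      linarith [hI d hb]
    refine (pi_norm_le_iff_of_nonneg (by positivity)).2 fun i => ?_
    have h6 : |e s i| ≤ ∑ i, |e s i| :=
      Finset.single_le_sum (fun i _ => abs_nonneg (e s i)) (Finset.mem_univ i)
    rw [Real.norm_eq_abs]
    linarith
  · have hT := hTpos ht
    obtain ⟨c, hc0, hcX⟩ := (H hT).flow.exists_weight_lower_bound hT.le
    obtain ⟨S, I, hS, -, hlow, hmain⟩ := (H hT).abs_dissipation ht hLc he hc0 hcX hδ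
    have hterm : ∀ j i, 0 ≤ m i * |e (t (j + 1)) i| := fun j i =>
      mul_nonneg (hm i).le (abs_nonneg _)
    have hsum : Summable fun j => S j + ∑ i, m i * |e (t (j + 1)) i| := by
      refine summable_of_sum_range_le
        (fun j => add_nonneg (hS j) (Finset.sum_nonneg fun i _ => hterm j i)) (c := I) fun k => ?_
      have h := hmain k _ (right_mem_Ioc.2 (ht.lt_succ k))
      have h3 : 0 ≤ ∫ r in (0 : ℝ)..(t (k + 1)), ∑ i, q i * |e r i| :=
        intervalIntegral.integral_nonneg (ht.nonneg _) fun r _ => Finset.sum_nonneg fun i _ =>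
          mul_nonneg ((H hT).flow.output_weight_nonneg i) (abs_nonneg _)
      have h4 : 0 ≤ c * vecL1 (e (t (k + 1))) :=
        mul_nonneg hc0.le (Finset.sum_nonneg fun i _ => abs_nonneg _)
      simp only [vecL1, Pi.zero_apply, abs_zero, Finset.sum_const_zero,
        intervalIntegral.integral_zero, add_zero, mul_zero] at h h4
      linarith
    have hlim := hsum.tendsto_atTop_zero
    have hSlim : Tendsto S atTop (𝓝 0) := squeeze_zero hS
      (fun j => le_add_of_nonneg_right (Finset.sum_nonneg fun i _ => hterm j i)) hlim
    refine tendsto_pi_nhds.2 fun i => ?_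
    have helim : Tendsto (fun j => |e (t (j + 1)) i|) atTop (𝓝 0) := by
      have h1 : Tendsto (fun j => m i * |e (t (j + 1)) i|) atTop (𝓝 0) :=
        squeeze_zero (fun j => hterm j i) (fun j => (Finset.single_le_sum
          (fun i _ => hterm j i) (Finset.mem_univ i)).trans (le_add_of_nonneg_left (hS j))) hlim
      simpa [← mul_assoc, inv_mul_cancel₀ (hm i).ne'] using h1.const_mul (m i)⁻¹
    have hb : Tendsto (fun k => Real.exp (α / c * Tmax) * (|e (t (k + 1)) i| + S k / c)) atTop
        (𝓝 0) := by
      simpa using (helim.add (hSlim.div_const c)).const_mul (Real.exp (α / c * Tmax))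
    refine Metric.tendsto_atTop.2 fun ε hε => ?_
    obtain ⟨N, hN⟩ := eventually_atTop.1 (hb.eventually_lt_const hε)
    -- Any time strictly after `t N` lies in a flow interval of index at least `N`.
    refine ⟨t N + 1, fun s hs => ?_⟩
    have hNs : t N < s := by linarith
    obtain ⟨k, hk⟩ := ht.exists_mem_Ioc ((ht.nonneg N).trans_lt hNs)
    have hkN : N ≤ k := by
      by_contra! hlt
      exact absurd (hNs.trans_le (hk.2.trans (ht.monotone hlt))) (lt_irrefl _)
    simpa using (hlow k s hk i).trans_lt (hN k hkN)

/-- For a nonnegative matrix the `1`-norm of the output is at most the column sums paired with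
`|e|`, so the weights `q`, `m` dominate the performance outputs. The finite-horizon bound is uniform
in `k` and passes to the limit. -/
theorem gain {Mc Md : Matrix (Fin n) (Fin n) ℝ}
    (H : 0 < Tmax → ErrorCertificate P Tmin Tmax X xd Lt Ld μ q m α γ)
    (hMc : EntrywiseNonneg Mc) (hMd : EntrywiseNonneg Md) (hγ : 0 ≤ γ)
    (hq : ∀ j, ∑ i, Mc i j ≤ q j) (hm : ∀ j, ∑ i, Md i j ≤ m j) :
    P.ErrorHybridGainLE Mc Md Tmin Tmax γ Lt Ld := by
  have hTpos : ∀ {t}, RangeDwellTime Tmin Tmax t → 0 < Tmax := fun ht =>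
    (sub_pos.2 (ht.lt_succ 0)).trans_le (ht.dwell_mem 0).2
  by_cases hT : 0 < Tmax
  swap
  · exact ⟨id, strictMono_id.strictMonoOn _, rfl, tendsto_id,
      fun t ht => absurd (hTpos ht) hT⟩
  set K := initialGain P X Ld μ with hK
  have hK0 : 0 ≤ K := (H hT).initialGain_nonneg
  have hK1 : 0 < K + 1 := by linarith
  -- `K` may be zero; the added `1` makes the function strictly increasing and unbounded.
  refine ⟨fun R => (K + 1) * R, (strictMono_mul_left_of_pos hK1).strictMonoOn _, mul_zero _,
    tendsto_id.const_mul_atTop hK1, fun t ht Lc hLc δc hδc δd hδd e ψ he R hR => ?_⟩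
  obtain ⟨c, hc0, hcX⟩ := (H hT).flow.exists_weight_lower_bound hT.le
  have hδabs : ∀ j, IntegrableOn (fun s => |δc s j|) (Ioi 0) := fun j => (hδc.eval j).abs
  have hδL1 : IntegrableOn (fun s => vecL1 (δc s)) (Ioi 0) :=
    integrable_finsetSum _ fun j _ => hδabs j
  have hvec : ∀ {k : ℕ} (v : Fin k → ℝ), 0 ≤ vecL1 v := fun v =>
    Finset.sum_nonneg fun i _ => abs_nonneg _
  have hR0 : 0 ≤ R := (norm_nonneg _).trans (hR.1 0 ⟨by linarith [P.hc_pos], le_rfl⟩)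
  obtain ⟨S, I, hS, hI, -, hmain⟩ := (H hT).abs_dissipation ht hLc he hc0 hcX fun r hr j =>
    (intervalIntegrable_iff_integrableOn_Ioc_of_le hr).2 ((hδabs j).mono_set Ioc_subset_Ioi_self)
  set Z := γ * ((∫ s in Ioi 0, vecL1 (δc s)) + ∑' k, vecL1 (δd (k + 1))) + (K + 1) * R with hZ
  have hM : ∀ {M : Matrix (Fin n) (Fin n) ℝ} {w : Fin n → ℝ}, EntrywiseNonneg M →
      (∀ j, ∑ i, M i j ≤ w j) → ∀ v, vecL1 (M *ᵥ v) ≤ ∑ i, w i * |v i| := fun hM hw v => by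
    have := skewAbs_mulVec_sum_le hM 1 v
    simp only [skewAbs_one] at this
    exact this.trans (Finset.sum_le_sum fun j _ =>
      mul_le_mul_of_nonneg_right (hw j) (abs_nonneg _))
  have hcont : ∀ M : Matrix (Fin n) (Fin n) ℝ, Continuous fun v => vecL1 (M *ᵥ v) := fun M => by
    unfold vecL1; fun_prop
  have hqcont : Continuous fun v : Fin n → ℝ => ∑ i, q i * |v i| := by fun_prop
  have hint : ∀ r, 0 ≤ r → IntervalIntegrable (fun s => vecL1 (Mc *ᵥ e s)) volume 0 r :=
    fun r hr => he.intervalIntegrable_comp ht P.hc_pos (hcont Mc) (by linarith [P.hc_pos])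
      (by linarith [P.hc_pos])
  have hbound : ∀ k, (∫ s in (0 : ℝ)..(t (k + 1)), vecL1 (Mc *ᵥ e s)) +
      ∑ j ∈ Finset.range k, vecL1 (Md *ᵥ e (t (j + 1))) ≤ Z := fun k => by
    have h := hmain k _ (right_mem_Ioc.2 (ht.lt_succ k))
    have h0 := ht.nonneg (k + 1)
    have h1 : (∫ s in (0 : ℝ)..(t (k + 1)), vecL1 (Mc *ᵥ e s)) ≤
        ∫ s in (0 : ℝ)..(t (k + 1)), ∑ i, q i * |e s i| :=
      intervalIntegral.integral_mono_on h0 (hint _ h0)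
        (he.intervalIntegrable_comp ht P.hc_pos hqcont (by linarith [P.hc_pos])
          (by linarith [P.hc_pos])) fun s _ => hM hMc hq (e s)
    have h2 : ∑ j ∈ Finset.range k, vecL1 (Md *ᵥ e (t (j + 1))) ≤
        ∑ j ∈ Finset.range k, (S j + ∑ i, m i * |e (t (j + 1)) i|) :=
      Finset.sum_le_sum fun j _ => (hM hMd hm _).trans (le_add_of_nonneg_left (hS j))
    have h3 : (∫ s in (0 : ℝ)..(t (k + 1)), vecL1 (δc s)) ≤ ∫ s in Ioi 0, vecL1 (δc s) := by
      rw [intervalIntegral.integral_of_le h0]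
      exact setIntegral_mono_set hδL1 (ae_of_all _ fun s => hvec _)
        Ioc_subset_Ioi_self.eventuallyLE
    have h4 : ∑ j ∈ Finset.range k, vecL1 (δd (j + 1)) ≤ ∑' k, vecL1 (δd (k + 1)) :=
      hδd.sum_le_tsum _ fun j _ => hvec _
    have h5 := mul_le_mul_of_nonneg_left (add_le_add h3 h4) hγ
    have h6 := hI R hR
    have h7 := mul_nonneg hc0.le (hvec (e (t (k + 1))))
    rw [hZ]
    linarith
  have ht' : Tendsto (fun k => t (k + 1)) atTop atTop := (tendsto_add_atTop_iff_nat 1).2 ht.tendsto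
  have hIoi : IntegrableOn (fun s => vecL1 (Mc *ᵥ e s)) (Ioi 0) := by
    refine integrableOn_Ioi_of_intervalIntegral_norm_bounded Z 0 (fun k =>
      (intervalIntegrable_iff_integrableOn_Ioc_of_le (ht.nonneg (k + 1))).1 (hint _ (ht.nonneg _)))
      ht' (Eventually.of_forall fun k => ?_)
    simp only [Real.norm_of_nonneg (hvec _)]
    linarith [hbound k, Finset.sum_nonneg fun j (_ : j ∈ Finset.range k) =>
      hvec (Md *ᵥ e (t (j + 1)))]
  have hsumm : Summable fun k => vecL1 (Md *ᵥ e (t (k + 1))) := by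
    refine summable_of_sum_range_le (fun k => hvec _) (c := Z) fun k => ?_
    linarith [hbound k, intervalIntegral.integral_nonneg (μ := volume) (ht.nonneg (k + 1))
      fun s _ => hvec (Mc *ᵥ e s)]
  have hlim := (intervalIntegral_tendsto_integral_Ioi 0 hIoi ht').add
    hsumm.hasSum.tendsto_sum_nat
  exact ⟨hIoi, hsumm, le_of_tendsto' hlim hbound⟩

end ErrorCertificate

/-! ### From the matrix inequalities to the certificate. -/

theorem mainTheorem9 {n pc pd rc rd : ℕ} (P : ImpulsiveDelaySystem n pc pd rc rd)
    (Mc Md : Matrix (Fin n) (Fin n) ℝ) (hMc : EntrywiseNonneg Mc) (hMd : EntrywiseNonneg Md)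
    (Tmin Tmax : ℝ) (hTmin : 0 ≤ Tmin) (hTmax : Tmin ≤ Tmax)
    (X Xdot : ℝ → Matrix (Fin n) (Fin n) ℝ)
    (Yc : ℝ → Matrix (Fin n) (Fin rc) ℝ) (Yd : Matrix (Fin n) (Fin rd) ℝ)
    (Uc : Matrix (Fin n) (Fin n) ℝ) (ε α γ : ℝ) (hε : 0 < ε) (hα : 0 < α) (hγ : 0 < γ)
    (hXdiag : ∀ τ ∈ Icc 0 Tmax, (X τ).IsDiag)
    (hXdot : ∀ τ ∈ Icc 0 Tmax, ∀ i j,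
      HasDerivWithinAt (fun s => X s i j) (Xdot τ i j) (Icc 0 Tmax) τ)
    (hX0 : (X 0).PosDef) (hXinv : ∀ τ ∈ Icc 0 Tmax, IsUnit (X τ))
    (hUdiag : Uc.IsDiag) (hUpos : Uc.PosDef)
    (hA : ∀ τ ∈ Icc 0 Tmax,
      EntrywiseNonneg (X τ * P.A - Yc τ * P.Cyc + α • (1 : Matrix (Fin n) (Fin n) ℝ)))
    (hGc : ∀ τ ∈ Icc 0 Tmax, EntrywiseNonneg (X τ * P.Gc - Yc τ * P.Hyc))
    (hEc : ∀ τ ∈ Icc 0 Tmax, EntrywiseNonneg (X τ * P.Ec - Yc τ * P.Fyc))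
    (hJ : EntrywiseNonneg (X 0 * P.J - Yd * P.Cyd))
    (hGd : EntrywiseNonneg (X 0 * P.Gd - Yd * P.Hyd))
    (hEd : EntrywiseNonneg (X 0 * P.Ed - Yd * P.Fyd))
    (hflow : ∀ τ ∈ Icc 0 Tmax,
      1 ᵥ* (Xdot τ + X τ * P.A - Yc τ * P.Cyc + Uc) + 1 ᵥ* Mc ≤ 0)
    (hflowDelay : ∀ τ ∈ Icc 0 Tmax, 1 ᵥ* (X τ * P.Gc - Yc τ * P.Hyc - Uc) ≤ 0)
    (hflowGain : ∀ τ ∈ Icc 0 Tmax,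
      1 ᵥ* (X τ * P.Ec - Yc τ * P.Fyc) - γ • (1 : Fin pc → ℝ) ≤ 0)
    (hjump : ∀ θ ∈ Icc Tmin Tmax,
      1 ᵥ* (X 0 * (P.J + P.Gd) - Yd * (P.Cyd + P.Hyd) - X θ
        + ε • (1 : Matrix (Fin n) (Fin n) ℝ)) + 1 ᵥ* Md ≤ 0)
    (hjumpGain : 1 ᵥ* (X 0 * P.Ed - Yd * P.Fyd) - γ • (1 : Fin pd → ℝ) ≤ 0) :
    P.IsIntervalObserver Tmin Tmax (fun τ => (X τ)⁻¹ * Yc τ) ((X 0)⁻¹ * Yd) ∧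
    P.SolvesObservationProblem Mc Md Tmin Tmax γ
      (fun τ => (X τ)⁻¹ * Yc τ) ((X 0)⁻¹ * Yd) := by
  have h0T : (0 : ℝ) ≤ Tmax := hTmin.trans hTmax
  have h0mem : (0 : ℝ) ∈ Icc 0 Tmax := ⟨le_rfl, h0T⟩
  have hcancel : ∀ {r k : ℕ} {τ : ℝ}, τ ∈ Icc 0 Tmax → ∀ (M : Matrix (Fin n) (Fin k) ℝ)
      (Y : Matrix (Fin n) (Fin r) ℝ) (C : Matrix (Fin r) (Fin k) ℝ),
      X τ * (M - (X τ)⁻¹ * Y * C) = X τ * M - Y * C := fun hτ M Y C => by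
    rw [Matrix.mul_sub, Matrix.mul_assoc (X _)⁻¹,
      mul_nonsing_inv_cancel_left _ _ ((isUnit_iff_isUnit_det _).1 (hXinv _ hτ))]
  have hpos := diag_pos_of_isUnit hXdiag
    (fun i τ hτ => (hXdot τ hτ i i).continuousWithinAt) hX0 hXinv
  have hdiv : ∀ {r k : ℕ} {τ : ℝ}, τ ∈ Icc 0 Tmax → ∀ {M : Matrix (Fin n) (Fin k) ℝ}
      {Y : Matrix (Fin n) (Fin r) ℝ} {C : Matrix (Fin r) (Fin k) ℝ} {i : Fin n} {j : Fin k},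
      0 ≤ (X τ * M - Y * C) i j → 0 ≤ (M - (X τ)⁻¹ * Y * C) i j := fun {_ _ _} hτ {_ _ _ i _} h => by
    rw [← hcancel hτ, (hXdiag _ hτ).mul_apply] at h
    exact nonneg_of_mul_nonneg_right h (hpos _ hτ i)
  have hAoff : ∀ τ ∈ Icc 0 Tmax, ∀ i j, i ≠ j → 0 ≤ (X τ * P.A - Yc τ * P.Cyc) i j :=
    fun τ hτ i j hij => by simpa [one_apply_ne hij] using hA τ hτ i j
  -- The diagonal of `Uc` weights the continuous delay, and `ε` is put into the jump weight so that
  -- it is strictly positive even where `Md` has a zero column.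
  have hcert : 0 < Tmax → ErrorCertificate P Tmin Tmax X (fun τ i => Xdot τ i i)
      (fun τ => (X τ)⁻¹ * Yc τ) ((X 0)⁻¹ * Yd) (fun i => Uc i i) (fun j => ∑ i, Mc i j)
      (fun j => ε + ∑ i, Md i j) α γ := fun hT => by
    refine ⟨hXdiag, ⟨fun τ hτ i => hXdot τ hτ i i, hpos, hα, fun i => hUpos.diag_pos.le,
      fun j => Finset.sum_nonneg fun i _ => hMc i j, fun τ hτ i j hij => ?_, fun τ hτ i => ?_,
      fun τ hτ => ?_, fun τ hτ => ?_, fun τ hτ j => ?_, fun τ hτ j => ?_, fun τ hτ j => ?_⟩,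
      ⟨fun i => (hpos 0 h0mem i).le, ?_, ?_, ?_, fun θ hθ j => ?_, fun j => ?_⟩⟩
    · rw [hcancel hτ]; exact hAoff τ hτ i j hij
    · have := hA τ hτ i i
      rw [hcancel hτ]
      simp only [Matrix.add_apply, Matrix.smul_apply, one_apply_eq, smul_eq_mul, mul_one] at this
      linarith
    · simp only [hcancel hτ]; exact hGc τ hτ
    · simp only [hcancel hτ]; exact hEc τ hτ
    -- Off-diagonal entries of `Xdot` vanish by uniqueness of derivatives within `[0, Tmax]`, which
    -- requires `0 < Tmax`: on a single point they would be arbitrary.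
    · have hXd : ∑ i, Xdot τ i j = Xdot τ j j :=
        Finset.sum_eq_single j (fun i _ hij => (uniqueDiffOn_Icc hT τ hτ).eq_deriv _ (hXdot τ hτ i j)
          ((hasDerivWithinAt_const τ _ (0 : ℝ)).congr (fun s hs => hXdiag s hs hij)
            (hXdiag τ hτ hij))) (by simp)
      have hU : ∑ i, Uc i j = Uc j j :=
        Finset.sum_eq_single j (fun i _ hij => hUdiag hij) (by simp)
      have := hflow τ hτ j
      simp only [vecMul, dotProduct, Pi.add_apply, Pi.one_apply, Pi.zero_apply, one_mul, Matrix.add_apply,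
        Matrix.sub_apply, Finset.sum_add_distrib, Finset.sum_sub_distrib, hXd, hU] at this
      simp only [hcancel hτ, Matrix.sub_apply, Finset.sum_sub_distrib]
      linarith
    · have hU : ∑ i, Uc i j = Uc j j :=
        Finset.sum_eq_single j (fun i _ hij => hUdiag hij) (by simp)
      have := hflowDelay τ hτ j
      simp only [vecMul, dotProduct, Pi.one_apply, Pi.zero_apply, one_mul, Matrix.sub_apply,
        Finset.sum_sub_distrib, hU] at this
      simp only [hcancel hτ, Matrix.sub_apply, Finset.sum_sub_distrib]
      linarith
    · have := hflowGain τ hτ j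
      simp only [vecMul, dotProduct, Pi.sub_apply, Pi.smul_apply, smul_eq_mul, mul_one,
        Pi.one_apply, Pi.zero_apply, one_mul] at this
      simp only [hcancel hτ]
      linarith
    · rw [hcancel h0mem]; exact hJ
    · rw [hcancel h0mem]; exact hGd
    · rw [hcancel h0mem]; exact hEd
    · have hθ' : θ ∈ Icc 0 Tmax := ⟨hTmin.trans hθ.1, hθ.2⟩
      have hXs : ∑ i, X θ i j = X θ j j :=
        Finset.sum_eq_single j (fun i _ hij => hXdiag θ hθ' hij) (by simp)
      have hone : ∑ i, ε * (1 : Matrix (Fin n) (Fin n) ℝ) i j = ε := by simp [one_apply]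
      have := hjump θ hθ j
      simp only [vecMul, dotProduct, Pi.add_apply, Pi.one_apply, Pi.zero_apply, one_mul, Matrix.add_apply,
        Matrix.sub_apply, Matrix.smul_apply, smul_eq_mul, Matrix.mul_add, Finset.sum_add_distrib,
        Finset.sum_sub_distrib, hXs, hone] at this
      simp only [hcancel h0mem, Matrix.sub_apply, Finset.sum_sub_distrib]
      linarith
    · have := hjumpGain j
      simp only [vecMul, dotProduct, Pi.sub_apply, Pi.smul_apply, smul_eq_mul, mul_one,
        Pi.one_apply, Pi.zero_apply, one_mul] at this
      rw [hcancel h0mem]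
      linarith
  have hm : ∀ j, 0 < ε + ∑ i, Md i j := fun j =>
    add_pos_of_pos_of_nonneg hε (Finset.sum_nonneg fun i _ => hMd i j)
  refine ⟨ErrorCertificate.isIntervalObserver hcert fun j => (hm j).le,
    ⟨fun τ hτ i j hij => hdiv hτ (hAoff τ hτ i j hij), fun τ hτ i j => hdiv hτ (hGc τ hτ i j),
      fun τ hτ i j => hdiv hτ (hEc τ hτ i j), fun i j => hdiv h0mem (hJ i j),
      fun i j => hdiv h0mem (hGd i j), fun i j => hdiv h0mem (hEd i j)⟩,
    ErrorCertificate.stable hcert hm,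
    ErrorCertificate.gain hcert hMc hMd hγ.le (fun j => le_rfl) fun j =>
      le_add_of_nonneg_left hε.le⟩
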